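/- For $n\ge 0$ let ${\cal O}_n$ be the monoid presented by generators $p^i$ and $q^i$, for $0\le i\le n-2$ (no generators if $n<2$), subject to the following relations, for all indices for which the generators involved exist: \[ \begin{array}{ll} (p1) & p^i\circ p^j=p^j\circ p^i \quad (j+1<i),\\ (p2) & p^i\circ p^i=p^i,\\ (p3) & p^i\circ p^{i+1}\circ p^i=p^{i+1}\circ p^i\circ p^{i+1}=p^i\circ p^{i+1},\\ (q1) & q^i\circ q^j=q^j\circ q^i \quad (j+1<i),\\ (q2) & q^i\circ q^i=q^i,\\ (q3) & q^i\circ q^{i+1}\circ q^i=q^{i+1}\circ q^i\circ q^{i+1}=q^{i+1}\circ q^i,\\ (pq) & p^i\circ q^j=q^j\circ p^i \quad (j<i \mbox{ or } i+1<j),\\ (pq1) & p^i\circ q^i=p^i,\\ (pq2) & p^i\circ q^{i+1}=q^{i+1},\\ (qp1) & q^i\circ p^i=q^i,\\ (qp2) & q^{i+1}\circ p^i=p^i. \end{array} \] Terms of ${\cal O}_n$ are the formal expressions built from the generators and a symbol ${\bf 1}$ with the binary symbol $\circ$; each term denotes an element of ${\cal O}_n$, with ${\bf 1}$ denoting the unit,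 and "$x=y$ in ${\cal O}_n$" means that $x$ and $y$ denote the same element. Let $\sigma$ map terms to order-preserving functions from $n=\{0,\ldots,n-1\}$ to itself by: $\sigma(p^i)$ sends $i+1$ to $i$ and fixes all other points; $\sigma(q^i)$ sends $i$ to $i+1$ and fixes all other points; $\sigma({\bf 1})$ is the identity; and $\sigma(x\circ y)=\sigma(x)\circ\sigma(y)$. For $0\le j\le i\le n-2$ and $r\in\{p,q\}$, the block $r^{[i,j]}$ is $r^i\circ r^{i-1}\circ\cdots\circ r^{j+1}\circ r^j$. A term is in normal form if it is ${\bf 1}$ or is of the form $r_1^{[i_1,j_1]}\circ\cdots\circ r_m^{[i_m,j_m]}$ with $m\ge 1$, all parentheses being associated to the left, where for every $1\le k<m$: if $r_k=r_{k+1}$, then $i_k<i_{k+1}$ and $j_k<j_{k+1}$; if $r_k=p$ and $r_{k+1}=q$, then $i_k+1<j_{k+1}$; if $r_k=q$ and $r_{k+1}=p$, then $i_k<j_{k+1}$. Then: (1) For every $n\ge 0$, $\sigma$ induces an isomorphism from ${\cal O}_n$ onto the monoid of order-preserving endomorphisms of the ordinal $n$, i.e. the monoid of endomorphisms of the object $n$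 in the simplicial category $\Delta$ (finite ordinals, including $0$, with order-preserving functions). (2) For every $n\ge 0$ and every term $x$ of ${\cal O}_n$ there is a unique term $x'$ in normal form such that $x=x'$ in ${\cal O}_n$. (3) The word problem is solvable, uniformly in $n$: there is an algorithm that, given $n$ and a term $x$ of ${\cal O}_n$, computes the normal form $x'$ of $x$, and there is an algorithm that, given $n$ and terms $x,y$ of ${\cal O}_n$, decides whether $x=y$ in ${\cal O}_n$. -/

import Mathlib

namespace SimplicialEnd

/-- The generators of `O n`: right-forking `p i` and left-forking `q i` for `0 ≤ i ≤ n - 2`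
(none when `n < 2`, since then `Fin (n - 1)` is empty). -/
inductive Gen (n : ℕ) : Type
  | p (i : Fin (n - 1)) : Gen n
  | q (i : Fin (n - 1)) : Gen n

/-- The terms of `O n`: generated from `1` and the generators by the binary symbol `comp`. -/
inductive Term (n : ℕ) : Type
  | one : Term n
  | gen (g : Gen n) : Term n
  | comp (x y : Term n) : Term n

/-- The generator `p i` as an element of the free monoid. -/
def P {n : ℕ} (i : Fin (n - 1)) : FreeMonoid (Gen n) := FreeMonoid.of (Gen.p i)

/-- The generator `q i` as an element of the free monoid. -/
def Q {n : ℕ} (i : Fin (n - 1)) : FreeMonoid (Gen n) := FreeMonoid.of (Gen.q i)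

/-- The defining relations of `O n`. -/
inductive Rel (n : ℕ) : FreeMonoid (Gen n) → FreeMonoid (Gen n) → Prop
  | p1 (i j : Fin (n - 1)) (h : (j : ℕ) + 1 < i) : Rel n (P i * P j) (P j * P i)
  | p2 (i : Fin (n - 1)) : Rel n (P i * P i) (P i)
  | p3_left (i j : Fin (n - 1)) (h : (j : ℕ) = i + 1) :
      Rel n (P i * P j * P i) (P j * P i * P j)
  | p3_right (i j : Fin (n - 1)) (h : (j : ℕ) = i + 1) :
      Rel n (P j * P i * P j) (P i * P j)
  | q1 (i j : Fin (n - 1)) (h : (j : ℕ) + 1 < i) : Rel n (Q i * Q j) (Q j * Q i)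
  | q2 (i : Fin (n - 1)) : Rel n (Q i * Q i) (Q i)
  | q3_left (i j : Fin (n - 1)) (h : (j : ℕ) = i + 1) :
      Rel n (Q i * Q j * Q i) (Q j * Q i * Q j)
  | q3_right (i j : Fin (n - 1)) (h : (j : ℕ) = i + 1) :
      Rel n (Q j * Q i * Q j) (Q j * Q i)
  | pq (i j : Fin (n - 1)) (h : (j : ℕ) < i ∨ (i : ℕ) + 1 < j) :
      Rel n (P i * Q j) (Q j * P i)
  | pq1 (i : Fin (n - 1)) : Rel n (P i * Q i) (P i)
  | pq2 (i j : Fin (n - 1)) (h : (j : ℕ) = i + 1) : Rel n (P i * Q j) (Q j)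
  | qp1 (i : Fin (n - 1)) : Rel n (Q i * P i) (Q i)
  | qp2 (i j : Fin (n - 1)) (h : (j : ℕ) = i + 1) : Rel n (Q j * P i) (P i)

/-- The monoid `O n`, presented by generators and relations. -/
abbrev O (n : ℕ) : Type := PresentedMonoid (Rel n)

/-- The element of `O n` denoted by a term; terms `x`, `y` are equal in `O n` when
`x.val = y.val`. -/
def Term.val {n : ℕ} : Term n → O n
  | .one => 1
  | .gen g => PresentedMonoid.of (Rel n) g
  | .comp x y => x.val * y.val

/-- The right-forking endomorphism of the ordinal `n`: it sends `i + 1` to `i` and fixes every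
other point. -/
def rightFork {n : ℕ} (i : Fin (n - 1)) : Fin n →o Fin n where
  toFun j := if (j : ℕ) = i + 1 then ⟨i, by omega⟩ else j
  monotone' a b hab := by
    rw [Fin.le_def] at hab ⊢
    dsimp only
    split_ifs <;> first | omega | (dsimp only; omega)

/-- The left-forking endomorphism of the ordinal `n`: it sends `i` to `i + 1` and fixes every
other point. -/
def leftFork {n : ℕ} (i : Fin (n - 1)) : Fin n →o Fin n where
  toFun j := if (j : ℕ) = i then ⟨i + 1, by omega⟩ else j
  monotone' a b hab := by
    rw [Fin.le_def] at hab ⊢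
    dsimp only
    split_ifs <;> first | omega | (dsimp only; omega)

/-- The interpretation of terms as order-preserving endomorphisms of the ordinal `n`. -/
def sigma {n : ℕ} : Term n → (Fin n →o Fin n)
  | .one => OrderHom.id
  | .gen (.p i) => rightFork i
  | .gen (.q i) => leftFork i
  | .comp x y => (sigma x).comp (sigma y)

/-- The two kinds of blocks. -/
inductive Kind : Type
  | p : Kind
  | q : Kind

/-- The generator of a given kind and index. -/
def Kind.gen {n : ℕ} : Kind → Fin (n - 1) → Gen n
  | .p => Gen.p
  | .q => Gen.q

/-- A block `r^[i,j]`, where `r` is `p` or `q` and `0 ≤ j ≤ i ≤ n - 2`. -/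
structure Block (n : ℕ) : Type where
  kind : Kind
  i : Fin (n - 1)
  j : Fin (n - 1)
  le : (j : ℕ) ≤ i

/-- The generators `r^i, r^(i-1), …, r^(j+1), r^j` whose composition is the block `r^[i,j]`. -/
def Block.letters {n : ℕ} (b : Block n) : List (Gen n) :=
  List.ofFn fun k : Fin ((b.i : ℕ) - b.j + 1) => b.kind.gen ⟨(b.i : ℕ) - k, by omega⟩

/-- The condition on two consecutive blocks of a normal form. -/
def Block.Before {n : ℕ} (b c : Block n) : Prop :=
  match b.kind, c.kind with
  | .p, .p => (b.i : ℕ) < c.i ∧ (b.j : ℕ) < c.j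
  | .q, .q => (b.i : ℕ) < c.i ∧ (b.j : ℕ) < c.j
  | .p, .q => (b.i : ℕ) + 1 < c.j
  | .q, .p => (b.i : ℕ) < c.j

/-- The composition of a list of generators, with all parentheses associated to the left; the
composition of the empty list is the term `1`. -/
def leftComp {n : ℕ} : List (Gen n) → Term n
  | [] => .one
  | g :: l => l.foldl (fun t h => .comp t (.gen h)) (.gen g)

/-- A term is in normal form when it is `1` (the case of no blocks) or a composition of blocks
`r₁^[i₁,j₁] ∘ ⋯ ∘ r_m^[i_m,j_m]`, `m ≥ 1`, each two consecutive ones of which satisfy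
`Block.Before`. -/
def Term.IsNormal {n : ℕ} (t : Term n) : Prop :=
  ∃ w : List (Block n), w.IsChain Block.Before ∧ t = leftComp (w.flatMap Block.letters)

/-- Gödel numbers of terms, used to present terms to an algorithm. -/
def Term.code {n : ℕ} : Term n → ℕ
  | .one => 0
  | .gen (.p i) => 3 * i + 1
  | .gen (.q i) => 3 * i + 2
  | .comp x y => 3 * Nat.pair x.code y.code + 3

theorem Term.code_injective {n : ℕ} : Function.Injective (Term.code (n := n)) := by
  intro x
  induction x with
  | one => rintro (_ | (i | i) | ⟨x, y⟩) h <;> simp [Term.code] at h ⊢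
  | gen g =>
    rcases g with i | i <;> rintro (_ | (j | j) | ⟨x, y⟩) h <;>
      simp only [Term.code, Term.gen.injEq, Gen.p.injEq, Gen.q.injEq, Fin.ext_iff] at h ⊢ <;> omega
  | comp x y hx hy =>
    rintro (_ | (i | i) | ⟨z, w⟩) h
    · simp [Term.code] at h
    · simp only [Term.code] at h; omega
    · simp only [Term.code] at h; omega
    · have h' : Nat.pair x.code y.code = Nat.pair z.code w.code := by
        simp only [Term.code] at h; omega
      obtain ⟨h1, h2⟩ := Nat.pair_eq_pair.1 h'
      rw [hx h1, hy h2]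

end SimplicialEnd

/-! The relations hold for the forking functions by a pointwise check, so $\sigma$ induces a
homomorphism `sigmaHom` on `O n`. It is bijective for three reasons.

Normal forms exist (`ForkRel.hasNormal`). Only the relations are used, so the argument runs in any
monoid satisfying `ForkRel`. A product of letters with index at most `N` can be rewritten so that
letters with index `N` occur in at most one block, standing at the right end
(`ForkRel.hasTop_of_mem_lowerSubmonoid`). The rest is normalised by induction. If its last block
does not fit before the top block, a rewriting rule for two blocks either raises the lower index of
a top `p`-block or shortens what precedes a top `q`-block, so the process ends.

A normal form is determined by its function (`eq_of_blocksAct_eq`). The greatest moved point, the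
direction in which it moves, and then the fibre structure (for `p`) or the set sent to the top value
(for `q`) reveal the last block. The function of the remaining blocks can also be recovered, and
induction finishes. Hence elements of `O n` with equal images have the same normal form, which gives
injectivity and uniqueness.

The forks generate all monotone functions (`mem_lowerSubmonoid_of_monotone`): such a function
factors through a top block, with a quotient that lives on a smaller ordinal.

Since $\sigma$ is faithful, the word problem amounts to comparing two functions at `n` points, a
primitive recursive test. The normal form is then found by unbounded search, which stops because a
normal form always exists. -/

namespace SimplicialEnd

/-! ### Rewriting rules for letters and blocks -/

/-- The relations of `O n` for families indexed by natural numbers, in any monoid. -/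
structure ForkRel {M : Type*} [Monoid M] (m : ℕ) (p q : ℕ → M) : Prop where
  p_comm : ∀ i j, i < m → j + 1 < i → Commute (p i) (p j)
  p_idem : ∀ i, i < m → p i * p i = p i
  p_left : ∀ i, i + 1 < m → p i * (p (i + 1) * p i) = p i * p (i + 1)
  p_right : ∀ i, i + 1 < m → p (i + 1) * (p i * p (i + 1)) = p i * p (i + 1)
  q_comm : ∀ i j, i < m → j + 1 < i → Commute (q i) (q j)
  q_idem : ∀ i, i < m → q i * q i = q i
  q_left : ∀ i, i + 1 < m → q i * (q (i + 1) * q i) = q (i + 1) * q i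
  q_right : ∀ i, i + 1 < m → q (i + 1) * (q i * q (i + 1)) = q (i + 1) * q i
  pq_comm : ∀ i j, i < m → j < m → (j < i ∨ i + 1 < j) → Commute (p i) (q j)
  pq_same : ∀ i, i < m → p i * q i = p i
  pq_succ : ∀ i, i + 1 < m → p i * q (i + 1) = q (i + 1)
  qp_same : ∀ i, i < m → q i * p i = q i
  qp_succ : ∀ i, i + 1 < m → q (i + 1) * p i = p i

/-- The product `r (b - 1) * ⋯ * r (a + 1) * r a`, which is `1` when `b ≤ a`. -/
def down {M : Type*} [Monoid M] (r : ℕ → M) (a : ℕ) : ℕ → M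
  | 0 => 1
  | b + 1 => if a ≤ b then r b * down r a b else 1

section down

variable {M : Type*} [Monoid M] (r : ℕ → M)

theorem down_of_le {a b : ℕ} (h : b ≤ a) : down r a b = 1 := by
  cases b with
  | zero => rfl
  | succ b => rw [down, if_neg (by omega)]

theorem down_succ {a b : ℕ} (h : a ≤ b) : down r a (b + 1) = r b * down r a b := by
  rw [down, if_pos h]

theorem down_single (a : ℕ) : down r a (a + 1) = r a := by
  rw [down_succ r le_rfl, down_of_le r le_rfl, mul_one]

theorem down_split {a c b : ℕ} (h : a ≤ c) (h' : c ≤ b) :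
    down r a b = down r c b * down r a c := by
  induction b, h' using Nat.le_induction with
  | base => rw [down_of_le r le_rfl, one_mul]
  | succ b hb ih => rw [down_succ r (h.trans hb), down_succ r hb, ih, mul_assoc]

theorem down_last {a b : ℕ} (h : a < b) : down r a b = down r (a + 1) b * r a := by
  rw [down_split r (Nat.le_succ a) h, down_single]

/-- Splitting off the two factors with indices `k + 1` and `k`. -/
theorem down_split_two {j k b : ℕ} (hj : j ≤ k) (hb : k + 1 < b) :
    down r j b = down r (k + 2) b * (r (k + 1) * (r k * down r j k)) := by
  rw [down_split r (show j ≤ k + 2 by omega) hb, down_succ r (by omega), down_succ r hj]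

variable {r}

theorem commute_down {x : M} {a b : ℕ} (h : ∀ c, a ≤ c → c < b → Commute x (r c)) :
    Commute x (down r a b) := by
  induction b with
  | zero => exact Commute.one_right x
  | succ b ih =>
    rcases le_or_gt a b with hab | hab
    · rw [down_succ r hab]
      exact (h b hab (by omega)).mul_right (ih fun c h1 h2 => h c h1 (by omega))
    · rw [down_of_le r hab]
      exact Commute.one_right x

theorem down_mul_eq {x : M} {a b : ℕ} (h : ∀ c, a ≤ c → c < b → r c * x = x) :
    down r a b * x = x := by
  induction b with
  | zero => exact one_mul x
  | succ b ih =>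
    rcases le_or_gt a b with hab | hab
    · rw [down_succ r hab, mul_assoc, ih fun c h1 h2 => h c h1 (by omega), h b hab (by omega)]
    · rw [down_of_le r hab, one_mul]

theorem mul_down_eq {x : M} {a b : ℕ} (h : ∀ c, a ≤ c → c < b → x * r c = x) :
    x * down r a b = x := by
  induction b with
  | zero => exact mul_one x
  | succ b ih =>
    rcases le_or_gt a b with hab | hab
    · rw [down_succ r hab, ← mul_assoc, h b hab (by omega), ih fun c h1 h2 => h c h1 (by omega)]
    · rw [down_of_le r hab, mul_one]

end down

namespace ForkRel

variable {M : Type*} [Monoid M] {m : ℕ} {p q : ℕ → M} (R : ForkRel m p q)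
include R

theorem p_comm' {i j : ℕ} (hi : i < m) (hj : j < m) (h : j + 1 < i ∨ i + 1 < j) :
    Commute (p i) (p j) :=
  h.elim (R.p_comm i j hi) fun h => (R.p_comm j i hj h).symm

theorem q_comm' {i j : ℕ} (hi : i < m) (hj : j < m) (h : j + 1 < i ∨ i + 1 < j) :
    Commute (q i) (q j) :=
  h.elim (R.q_comm i j hi) fun h => (R.q_comm j i hj h).symm

/-- The letter slides left past the lower indices and meets $p^{k+1}p^k$. The two halves of (p3)
turn $p^{k+1}p^kp^{k+1}$ into $p^kp^{k+1}p^k$, and $p^k$ commutes with everything further left. -/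
theorem down_p_mul_p {j k b : ℕ} (hb : b ≤ m) (hj : j ≤ k) (hk : k + 1 < b) :
    down p j b * p (k + 1) = p k * down p j b := by
  have h1 : Commute (p (k + 1)) (down p j k) :=
    commute_down fun c _ _ => R.p_comm' (by omega) (by omega) (by omega)
  have h2 : Commute (p k) (down p (k + 2) b) :=
    commute_down fun c _ _ => R.p_comm' (by omega) (by omega) (by omega)
  have e1 := R.p_left k (by omega)
  have e2 := R.p_right k (by omega)
  rw [down_split_two p hj hk]
  calc _ = down p (k + 2) b * (p (k + 1) * (p k * (down p j k * p (k + 1)))) := by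
        simp only [mul_assoc]
    _ = down p (k + 2) b * (p (k + 1) * (p k * p (k + 1))) * down p j k := by
        rw [← h1.eq]; simp only [mul_assoc]
    _ = (down p (k + 2) b * p k) * (p (k + 1) * p k) * down p j k := by
        rw [e2, ← e1]; simp only [mul_assoc]
    _ = _ := by rw [← h2.eq]; simp only [mul_assoc]

/-- A `q` inside a `p`-block cuts it in two: it swallows $p^k$ by (pq2) and is then swallowed by
$p^{k+1}$ by (pq1). The pieces are separated by the missing index, hence commute, and the one with
the top index is put last. -/
theorem down_p_mul_q {j k b : ℕ} (hb : b ≤ m) (hj : j ≤ k) (hk : k + 1 < b) :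
    down p j b * q (k + 1) = down p j k * down p (k + 1) b := by
  have h1 : Commute (q (k + 1)) (down p j k) :=
    commute_down fun c _ _ => (R.pq_comm _ _ (by omega) (by omega) (by omega)).symm
  have h2 : Commute (p (k + 1)) (down p j k) :=
    commute_down fun c _ _ => R.p_comm' (by omega) (by omega) (by omega)
  have h3 : Commute (down p j k) (down p (k + 1) b) :=
    commute_down fun c _ _ => (commute_down fun c' _ _ =>
      R.p_comm' (by omega) (by omega) (by omega)).symm
  rw [h3.eq, down_split_two p hj hk, down_last p hk]
  calc _ = down p (k + 2) b * (p (k + 1) * (p k * (down p j k * q (k + 1)))) := by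
        simp only [mul_assoc]
    _ = down p (k + 2) b * (p (k + 1) * ((p k * q (k + 1)) * down p j k)) := by
        rw [← h1.eq]; simp only [mul_assoc]
    _ = down p (k + 2) b * ((p (k + 1) * q (k + 1)) * down p j k) := by
        rw [R.pq_succ k (by omega)]; simp only [mul_assoc]
    _ = _ := by rw [R.pq_same _ (by omega)]; simp only [mul_assoc]

theorem down_p_mul_q_same {j b : ℕ} (hb : b ≤ m) (hj : j < b) :
    down p j b * q j = down p j b := by
  rw [down_last p hj, mul_assoc, R.pq_same _ (by omega)]

theorem down_p_mul_p_same {j b : ℕ} (hb : b ≤ m) (hj : j < b) :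
    down p j b * p j = down p j b := by
  rw [down_last p hj, mul_assoc, R.p_idem _ (by omega)]

theorem down_q_mul_q {j k b : ℕ} (hb : b ≤ m) (hj : j ≤ k) (hk : k < b) :
    down q j b * q k = down q j b := by
  rcases hj.eq_or_lt with rfl | hj
  · rw [down_last q hk, mul_assoc, R.q_idem _ (by omega)]
  obtain ⟨k, rfl⟩ : ∃ l, k = l + 1 := ⟨k - 1, by omega⟩
  have h1 : Commute (q (k + 1)) (down q j k) :=
    commute_down fun c _ _ => R.q_comm' (by omega) (by omega) (by omega)
  rw [down_split_two q (by omega) hk]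
  calc _ = down q (k + 2) b * (q (k + 1) * (q k * (down q j k * q (k + 1)))) := by
        simp only [mul_assoc]
    _ = down q (k + 2) b * (q (k + 1) * (q k * q (k + 1))) * down q j k := by
        rw [← h1.eq]; simp only [mul_assoc]
    _ = _ := by rw [R.q_right k (by omega)]; simp only [mul_assoc]

theorem down_q_mul_p {j k b : ℕ} (hb : b ≤ m) (hj : j ≤ k) (hk : k < b) :
    down q j b * p k = down q j b := by
  have h1 : Commute (p k) (down q j k) :=
    commute_down fun c _ _ => R.pq_comm _ _ (by omega) (by omega) (by omega)
  rw [down_split q hj hk.le, mul_assoc, ← h1.eq, ← mul_assoc, down_last q hk,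
    mul_assoc _ (q k), R.qp_same _ (by omega)]

theorem down_q_mul_p_pred {j b : ℕ} (hb : b ≤ m) (hj : j + 1 < b) :
    down q (j + 1) b * p j = p j * down q (j + 2) b := by
  have h1 : Commute (p j) (down q (j + 2) b) :=
    commute_down fun c _ _ => R.pq_comm _ _ (by omega) (by omega) (by omega)
  rw [down_last q hj, mul_assoc, R.qp_succ _ (by omega), h1.eq]

theorem p_mul_down_q {i j b : ℕ} (hb : b ≤ m) (hj : j ≤ i + 1) (hi : i + 1 < b) :
    p i * down q j b = down q j b := by
  have h1 : Commute (p i) (down q (i + 2) b) :=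
    commute_down fun c _ _ => R.pq_comm _ _ (by omega) (by omega) (by omega)
  rw [down_split q (show j ≤ i + 2 by omega) hi, down_succ q hj, ← mul_assoc, h1.eq, mul_assoc,
    ← mul_assoc (p i), R.pq_succ _ (by omega)]

theorem q_mul_down_q {i j b : ℕ} (hb : b ≤ m) (hj : j ≤ i) (hi : i + 1 < b) :
    q i * down q j b = down q j b := by
  have h1 : Commute (q i) (down q (i + 2) b) :=
    commute_down fun c _ _ => R.q_comm' (by omega) (by omega) (by omega)
  rw [down_split_two q hj hi, ← mul_assoc, h1.eq, mul_assoc, ← mul_assoc (q (i + 1)),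
    ← mul_assoc (q i), R.q_left _ (by omega)]

theorem down_p_mul_down_q_of_le {j k a b : ℕ} (hb : b ≤ m) (hj : j ≤ k + 1) (ha : a < b) :
    down p k a * down q j b = down q j b :=
  down_mul_eq fun _ _ _ => R.p_mul_down_q hb (by omega) (by omega)

theorem down_p_mul_down_q_of_lt {j k a b : ℕ} (hb : b ≤ m) (hj : k + 1 < j) (hj' : j ≤ a)
    (ha : a < b) : down p k a * down q j b = down p k (j - 1) * down q j b := by
  have h1 : Commute (down p k (j - 1)) (down q j b) :=
    commute_down fun c _ _ => (commute_down fun c' _ _ =>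
      (R.pq_comm _ _ (by omega) (by omega) (by omega)).symm).symm
  rw [down_split p (show k ≤ j - 1 by omega) (show j - 1 ≤ a by omega), mul_assoc, h1.eq,
    ← mul_assoc, R.down_p_mul_down_q_of_le hb (by omega) ha]

theorem down_q_mul_down_q {j k a b : ℕ} (hb : b ≤ m) (hj : j ≤ k) (ha : a < b) :
    down q k a * down q j b = down q j b :=
  down_mul_eq fun _ _ _ => R.q_mul_down_q hb (by omega) (by omega)

/-- The lowest letter of the second block is redundant after the first. The base case is half of
(p3); in the induction step the new top letter of the second block commutes with the lower part of
the first. -/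
theorem down_p_mul_down_p_succ {k a : ℕ} (ha : a + 1 ≤ m) (hk : k < a) :
    down p k a * down p k (a + 1) = down p k a * down p (k + 1) (a + 1) := by
  induction a, hk using Nat.le_induction with
  | base =>
    rw [down_succ p (show k ≤ k + 1 by omega), down_single, down_single]
    exact R.p_left k (by omega)
  | succ a hk ih =>
    have hk' : k < a := hk
    have h1 : Commute (p (a + 1)) (down p k a) :=
      commute_down fun c _ _ => R.p_comm' (by omega) (by omega) (by omega)
    rw [down_succ p (show k ≤ a + 1 by omega), down_succ p (show k + 1 ≤ a + 1 by omega),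
      down_succ p (show k ≤ a by omega)]
    rw [down_succ p (show k ≤ a by omega)] at ih
    calc _ = p a * ((down p k a * p (a + 1)) * (p a * down p k a)) := by simp only [mul_assoc]
      _ = p a * (p (a + 1) * (down p k a * (p a * down p k a))) := by
        rw [← h1.eq]; simp only [mul_assoc]
      _ = p a * ((p (a + 1) * down p k a) * down p (k + 1) (a + 1)) := by
        rw [ih (by omega)]; simp only [mul_assoc]
      _ = _ := by rw [h1.eq]; simp only [mul_assoc]

/-- The letter $p^k$ of the second block is redundant after the first one; once it is gone, the
letters below it commute with those above and move left to extend the first block. The second block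
thus starts strictly higher. -/
theorem down_p_mul_down_p {j k a b : ℕ} (hb : b ≤ m) (hj : j ≤ k) (hk : k < a) (ha : a < b) :
    down p k a * down p j b = down p j a * down p (k + 1) b := by
  have h1 : Commute (down p j k) (down p (k + 1) b) :=
    commute_down fun c _ _ => (commute_down fun c' _ _ =>
      R.p_comm' (by omega) (by omega) (by omega)).symm
  have h2 : Commute (down p k a) (down p (a + 1) b) :=
    commute_down fun c _ _ => (commute_down fun c' _ _ =>
      R.p_comm' (by omega) (by omega) (by omega)).symm
  have h3 : down p k a * down p k b = down p k a * down p (k + 1) b := by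
    rw [down_split p (show k ≤ a + 1 by omega) ha,
      down_split p (show k + 1 ≤ a + 1 by omega) ha, ← mul_assoc, h2.eq, mul_assoc,
      R.down_p_mul_down_p_succ (by omega) hk, ← mul_assoc, ← h2.eq, mul_assoc]
  rw [down_split p hj (show k ≤ b by omega), ← mul_assoc, h3, down_split p hj hk.le, mul_assoc,
    ← h1.eq, mul_assoc]

theorem down_q_mul_down_p_of_le {j k a b : ℕ} (hb : b ≤ m) (hj : k ≤ j) (hj' : j < a)
    (ha : a < b) : down q k a * down p j b = down q k a * down p a b := by
  have h1 : Commute (down q k a) (down p a b) :=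
    commute_down fun c _ _ => (commute_down fun c' _ _ =>
      R.pq_comm _ _ (by omega) (by omega) (by omega)).symm
  rw [down_split p hj'.le ha.le, ← mul_assoc, h1.eq, mul_assoc,
    mul_down_eq fun c _ _ => R.down_q_mul_p (by omega) (by omega) (by omega)]

/-- The `p`-letters with indices in `[k, a)` are absorbed by the `q`-block, while $p^{k-1}$ absorbs
$q^k$ by (qp2). All other letters commute past. -/
theorem down_q_mul_down_p_of_lt {j k a b : ℕ} (hb : b ≤ m) (hj : j < k) (hk : k < a)
    (ha : a < b) :
    down q k a * down p j b = down p j k * down q (k + 1) a * down p a b := by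
  have h1 : Commute (down q k a) (down p a b) :=
    commute_down fun c _ _ => (commute_down fun c' _ _ =>
      R.pq_comm _ _ (by omega) (by omega) (by omega)).symm
  have h2 : Commute (down q (k + 1) a) (down p a b) :=
    commute_down fun c _ _ => (commute_down fun c' _ _ =>
      R.pq_comm _ _ (by omega) (by omega) (by omega)).symm
  have h3 : Commute (down p j k) (down p a b) :=
    commute_down fun c _ _ => (commute_down fun c' _ _ =>
      R.p_comm' (by omega) (by omega) (by omega)).symm
  have h4 : down q k a * down p k a = down q k a :=
    mul_down_eq fun c _ _ => R.down_q_mul_p (by omega) (by omega) (by omega)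
  have h5 : down q k a * down p j k = down p j k * down q (k + 1) a := by
    obtain ⟨k, rfl⟩ : ∃ l, k = l + 1 := ⟨k - 1, by omega⟩
    have h6 : Commute (down p j k) (down q (k + 2) a) :=
      commute_down fun c _ _ => (commute_down fun c' _ _ =>
        (R.pq_comm _ _ (by omega) (by omega) (by omega)).symm).symm
    rw [down_succ p (by omega), ← mul_assoc, R.down_q_mul_p_pred (by omega) hk, mul_assoc,
      ← h6.eq, mul_assoc]
  rw [down_split p (show j ≤ a by omega) ha.le, ← mul_assoc, h1.eq, mul_assoc,
    down_split p hj.le hk.le, ← mul_assoc (down q k a), h4, h5, ← mul_assoc, ← h3.eq, mul_assoc,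
    ← h2.eq, mul_assoc]

end ForkRel

/-! ### Isolating the block with the highest index -/

/-- The submonoid generated by the members with index `< b` of two families. -/
def lowerSubmonoid {M : Type*} [Monoid M] (p q : ℕ → M) (b : ℕ) : Submonoid M :=
  Submonoid.closure {x | ∃ i < b, x = p i ∨ x = q i}

section lowerSubmonoid

variable {M : Type*} [Monoid M] {p q : ℕ → M}

theorem p_mem_lowerSubmonoid {i b : ℕ} (h : i < b) : p i ∈ lowerSubmonoid p q b :=
  Submonoid.subset_closure ⟨i, h, .inl rfl⟩

theorem q_mem_lowerSubmonoid {i b : ℕ} (h : i < b) : q i ∈ lowerSubmonoid p q b :=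
  Submonoid.subset_closure ⟨i, h, .inr rfl⟩

theorem lowerSubmonoid_mono {a b : ℕ} (h : a ≤ b) :
    lowerSubmonoid p q a ≤ lowerSubmonoid p q b :=
  Submonoid.closure_mono fun _ ⟨i, hi, hx⟩ => ⟨i, hi.trans_le h, hx⟩

theorem down_mem {S : Submonoid M} {r : ℕ → M} {a b : ℕ} (h : ∀ c < b, r c ∈ S) :
    down r a b ∈ S := by
  induction b with
  | zero => exact one_mem S
  | succ b ih =>
    rw [down]
    split_ifs
    · exact mul_mem (h b (by omega)) (ih fun c hc => h c (by omega))
    · exact one_mem S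

theorem down_p_mem_lowerSubmonoid {a c b : ℕ} (h : c ≤ b) :
    down p a c ∈ lowerSubmonoid p q b :=
  down_mem fun _ hc => p_mem_lowerSubmonoid (hc.trans_le h)

theorem down_q_mem_lowerSubmonoid {a c b : ℕ} (h : c ≤ b) :
    down q a c ∈ lowerSubmonoid p q b :=
  down_mem fun _ hc => q_mem_lowerSubmonoid (hc.trans_le h)

/-- Being a product of an element of `lowerSubmonoid p q N` with at most one block whose highest
index is `N`. -/
def HasTop (p q : ℕ → M) (N : ℕ) (x : M) : Prop :=
  ∃ v ∈ lowerSubmonoid p q N, x = v ∨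
    ∃ j ≤ N, x = v * down p j (N + 1) ∨ x = v * down q j (N + 1)

theorem HasTop.mul_left {N : ℕ} {u x : M} (hu : u ∈ lowerSubmonoid p q N)
    (h : HasTop p q N x) : HasTop p q N (u * x) := by
  obtain ⟨v, hv, rfl | ⟨j, hj, rfl | rfl⟩⟩ := h
  · exact ⟨u * x, mul_mem hu hv, .inl rfl⟩
  · exact ⟨u * v, mul_mem hu hv, .inr ⟨j, hj, .inl (mul_assoc _ _ _).symm⟩⟩
  · exact ⟨u * v, mul_mem hu hv, .inr ⟨j, hj, .inr (mul_assoc _ _ _).symm⟩⟩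

theorem hasTop_p {N j : ℕ} (hj : j ≤ N) : HasTop p q N (down p j (N + 1)) :=
  ⟨1, one_mem _, .inr ⟨j, hj, .inl (one_mul _).symm⟩⟩

theorem hasTop_q {N j : ℕ} (hj : j ≤ N) : HasTop p q N (down q j (N + 1)) :=
  ⟨1, one_mem _, .inr ⟨j, hj, .inr (one_mul _).symm⟩⟩

theorem hasTop_of_mem {N : ℕ} {x : M} (h : x ∈ lowerSubmonoid p q N) : HasTop p q N x :=
  ⟨x, h, .inl rfl⟩

variable {m : ℕ} (R : ForkRel m p q)
include R

theorem ForkRel.hasTop_down_p_mul_p {N j k : ℕ} (hN : N < m) (hj : j ≤ N) (hk : k ≤ N) :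
    HasTop p q N (down p j (N + 1) * p k) := by
  rcases lt_trichotomy (k + 1) j with h | h | h
  · have : Commute (p k) (down p j (N + 1)) :=
      commute_down fun c _ _ => R.p_comm' (by omega) (by omega) (by omega)
    rw [← this.eq]
    exact (hasTop_p hj).mul_left (p_mem_lowerSubmonoid (by omega))
  · subst h
    rw [← down_last p (by omega)]
    exact hasTop_p hk
  · rcases (Nat.lt_succ_iff.mp h).eq_or_lt with rfl | h
    · rw [R.down_p_mul_p_same hN (by omega)]
      exact hasTop_p hj
    · obtain ⟨k, rfl⟩ : ∃ l, k = l + 1 := ⟨k - 1, by omega⟩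
      rw [R.down_p_mul_p hN (by omega) (by omega)]
      exact (hasTop_p hj).mul_left (p_mem_lowerSubmonoid (by omega))

theorem ForkRel.hasTop_down_p_mul_q {N j k : ℕ} (hN : N < m) (hj : j ≤ N) (hk : k ≤ N) :
    HasTop p q N (down p j (N + 1) * q k) := by
  rcases lt_trichotomy k j with h | rfl | h
  · have : Commute (q k) (down p j (N + 1)) :=
      commute_down fun c _ _ => (R.pq_comm _ _ (by omega) (by omega) (by omega)).symm
    rw [← this.eq]
    exact (hasTop_p hj).mul_left (q_mem_lowerSubmonoid (by omega))
  · rw [R.down_p_mul_q_same hN (by omega)]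
    exact hasTop_p hj
  · obtain ⟨k, rfl⟩ : ∃ l, k = l + 1 := ⟨k - 1, by omega⟩
    rw [R.down_p_mul_q hN (by omega) (by omega)]
    exact (hasTop_p hk).mul_left (down_p_mem_lowerSubmonoid (by omega))

theorem ForkRel.hasTop_down_q_mul_q {N j k : ℕ} (hN : N < m) (hj : j ≤ N) (hk : k ≤ N) :
    HasTop p q N (down q j (N + 1) * q k) := by
  rcases lt_trichotomy (k + 1) j with h | h | h
  · have : Commute (q k) (down q j (N + 1)) :=
      commute_down fun c _ _ => R.q_comm' (by omega) (by omega) (by omega)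
    rw [← this.eq]
    exact (hasTop_q hj).mul_left (q_mem_lowerSubmonoid (by omega))
  · subst h
    rw [← down_last q (by omega)]
    exact hasTop_q hk
  · rw [R.down_q_mul_q hN (by omega) (by omega)]
    exact hasTop_q hj

theorem ForkRel.hasTop_down_q_mul_p {N j k : ℕ} (hN : N < m) (hj : j ≤ N) (hk : k ≤ N) :
    HasTop p q N (down q j (N + 1) * p k) := by
  rcases lt_trichotomy (k + 1) j with h | h | h
  · have : Commute (p k) (down q j (N + 1)) :=
      commute_down fun c _ _ => R.pq_comm _ _ (by omega) (by omega) (by omega)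
    rw [← this.eq]
    exact (hasTop_q hj).mul_left (p_mem_lowerSubmonoid (by omega))
  · subst h
    rw [R.down_q_mul_p_pred hN (by omega)]
    refine HasTop.mul_left (p_mem_lowerSubmonoid (by omega)) ?_
    rcases hj.eq_or_lt with h | h
    · rw [down_of_le q (by omega)]
      exact hasTop_of_mem (one_mem _)
    · exact hasTop_q (by omega)
  · rw [R.down_q_mul_p hN (by omega) (by omega)]
    exact hasTop_q hj

/-- The form survives right multiplication by a letter: the four preceding lemmas show that a top
block times a letter again has at most one top block, preceded only by lower letters. -/
theorem ForkRel.hasTop_of_mem_lowerSubmonoid {N : ℕ} (hN : N < m) {x : M}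
    (hx : x ∈ lowerSubmonoid p q (N + 1)) : HasTop p q N x := by
  induction hx using Submonoid.closure_induction_right with
  | one => exact hasTop_of_mem (one_mem _)
  | mul_right x hx y hy ih =>
    obtain ⟨k, hk, hy⟩ := hy
    obtain ⟨v, hv, rfl | ⟨j, hj, rfl | rfl⟩⟩ := ih
    · refine HasTop.mul_left hv ?_
      rcases (Nat.lt_succ_iff.mp hk).eq_or_lt with rfl | hk
      · rcases hy with rfl | rfl
        · rw [← down_single p]; exact hasTop_p le_rfl
        · rw [← down_single q]; exact hasTop_q le_rfl
      · rcases hy with rfl | rfl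
        · exact hasTop_of_mem (p_mem_lowerSubmonoid hk)
        · exact hasTop_of_mem (q_mem_lowerSubmonoid hk)
    · rw [mul_assoc]
      refine HasTop.mul_left hv ?_
      rcases hy with rfl | rfl
      · exact R.hasTop_down_p_mul_p hN hj (by omega)
      · exact R.hasTop_down_p_mul_q hN hj (by omega)
    · rw [mul_assoc]
      refine HasTop.mul_left hv ?_
      rcases hy with rfl | rfl
      · exact R.hasTop_down_q_mul_p hN hj (by omega)
      · exact R.hasTop_down_q_mul_q hN hj (by omega)

end lowerSubmonoid

/-! ### Existence of normal forms -/

/-- The product denoted by a block for given families of elements of a monoid. -/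
def Block.elt {M : Type*} [Monoid M] (p q : ℕ → M) {n : ℕ} (b : Block n) : M :=
  match b.kind with
  | .p => down p b.j (b.i + 1)
  | .q => down q b.j (b.i + 1)

theorem Block.Before.i_lt {n : ℕ} {b c : Block n} (h : b.Before c) : (b.i : ℕ) < c.i := by
  have := b.le
  have := c.le
  rw [Block.Before] at h
  split at h <;> omega

theorem isChain_concat {n : ℕ} {w : List (Block n)} {c : Block n} :
    (w ++ [c]).IsChain Block.Before ↔
      w.IsChain Block.Before ∧ ∀ b ∈ w.getLast?, b.Before c := by
  simp [List.isChain_append]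

/-- In a chain of blocks, the last block has the highest index. -/
theorem i_lt_of_isChain_concat {n : ℕ} {w : List (Block n)} {c : Block n}
    (h : (w ++ [c]).IsChain Block.Before) : ∀ b ∈ w, (b.i : ℕ) < c.i := by
  induction w using List.reverseRecOn generalizing c with
  | nil => simp
  | append_singleton w d ih =>
    rw [isChain_concat] at h
    have hd : (d.i : ℕ) < c.i := (h.2 d (by simp)).i_lt
    intro b hb
    rcases List.mem_append.mp hb with hb | hb
    · exact (ih h.1 b hb).trans hd
    · rw [List.mem_singleton.mp hb]; exact hd

section normal

variable {M : Type*} [Monoid M] {p q : ℕ → M} {n : ℕ}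

/-- Being the product of a chain of blocks with indices `< b`. -/
def HasNormal (p q : ℕ → M) (n b : ℕ) (x : M) : Prop :=
  ∃ w : List (Block n), w.IsChain Block.Before ∧ (∀ c ∈ w, (c.i : ℕ) < b) ∧
    x = (w.map (Block.elt p q)).prod

theorem HasNormal.mono {a b : ℕ} (h : a ≤ b) {x : M} (hx : HasNormal p q n a x) :
    HasNormal p q n b x := by
  obtain ⟨w, hw, hb, rfl⟩ := hx
  exact ⟨w, hw, fun c hc => (hb c hc).trans_le h, rfl⟩

theorem Block.elt_mem_lowerSubmonoid (c : Block n) {b : ℕ} (h : (c.i : ℕ) < b) :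
    c.elt p q ∈ lowerSubmonoid p q b := by
  rw [Block.elt]
  split
  · exact down_p_mem_lowerSubmonoid h
  · exact down_q_mem_lowerSubmonoid h

theorem prod_mem_lowerSubmonoid {w : List (Block n)} {b : ℕ} (h : ∀ c ∈ w, (c.i : ℕ) < b) :
    (w.map (Block.elt p q)).prod ∈ lowerSubmonoid p q b := by
  refine Submonoid.list_prod_mem _ fun x hx => ?_
  obtain ⟨c, hc, rfl⟩ := List.mem_map.mp hx
  exact c.elt_mem_lowerSubmonoid (h c hc)

theorem hasNormal_concat {w : List (Block n)} {c : Block n}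
    (h : (w ++ [c]).IsChain Block.Before) :
    HasNormal p q n (c.i + 1) ((w.map (Block.elt p q)).prod * c.elt p q) := by
  refine ⟨w ++ [c], h, fun b hb => ?_, by simp⟩
  rcases List.mem_append.mp hb with hb | hb
  · have := i_lt_of_isChain_concat h b hb
    omega
  · rw [List.mem_singleton.mp hb]; omega

variable (R : ForkRel (n - 1) p q)
include R

/-- The induction is on `N - j`: whenever the last block of `v` does not fit, rewriting raises the
lower index of the top block, to `k + 1` or to `i + 1`. The altered left factor may be out of normal
form, but still lies below `N`, so `IH` renormalises it. -/
theorem ForkRel.hasNormal_mul_down_p {N : ℕ} (hN : N < n - 1)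
    (IH : ∀ v ∈ lowerSubmonoid p q N, HasNormal p q n N v) {j : ℕ} (hj : j ≤ N) {v : M}
    (hv : v ∈ lowerSubmonoid p q N) : HasNormal p q n (N + 1) (v * down p j (N + 1)) := by
  induction hd : N - j using Nat.strong_induction_on generalizing j v with
  | _ d ih =>
  subst hd
  obtain ⟨w, hw, hb, rfl⟩ := IH v hv
  let c : Block n := ⟨.p, ⟨N, hN⟩, ⟨j, by omega⟩, hj⟩
  have hc : c.elt p q = down p j (N + 1) := rfl
  rcases List.eq_nil_or_concat' w with rfl | ⟨w, e, rfl⟩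
  · exact hc ▸ hasNormal_concat (c := c) (w := []) (by simp)
  by_cases h : e.Before c
  · exact hc ▸ hasNormal_concat (c := c) (isChain_concat.mpr ⟨hw, by simpa using h⟩)
  have hei : (e.i : ℕ) < N := hb e (by simp)
  have hw' : (w.map (Block.elt p q)).prod ∈ lowerSubmonoid p q N :=
    prod_mem_lowerSubmonoid fun b hb' => hb b (by simp [hb'])
  obtain ⟨kind, i, k, hki⟩ := e
  cases kind with
  | p =>
    have hjk : j ≤ k := by
      simp only [Block.Before, c] at h hei
      omega
    simp only at hei hki
    simp only [List.map_append, List.map_cons, List.map_nil, List.prod_append, List.prod_cons,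
      List.prod_nil, mul_one, Block.elt]
    rw [mul_assoc, R.down_p_mul_down_p (by omega) hjk (by omega) (by omega),
      ← mul_assoc]
    exact ih _ (by omega) (by omega)
      (mul_mem hw' (down_p_mem_lowerSubmonoid hei)) rfl
  | q =>
    have hjk : j ≤ i := by
      simp only [Block.Before, c] at h hei
      omega
    simp only at hei hki
    simp only [List.map_append, List.map_cons, List.map_nil, List.prod_append, List.prod_cons,
      List.prod_nil, mul_one, Block.elt]
    rcases le_or_gt (k : ℕ) j with hkj | hkj
    · rw [mul_assoc, R.down_q_mul_down_p_of_le (by omega) hkj (by omega) (by omega), ← mul_assoc]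
      exact ih _ (by omega) (by omega) (mul_mem hw' (down_q_mem_lowerSubmonoid hei)) rfl
    · rw [mul_assoc, R.down_q_mul_down_p_of_lt (by omega) hkj (by omega) (by omega), ← mul_assoc]
      exact ih _ (by omega) (by omega) (mul_mem hw' (mul_mem
        (down_p_mem_lowerSubmonoid (by omega)) (down_q_mem_lowerSubmonoid hei))) rfl

/-- Here the top block stays fixed and consumes from the left factor: an ill-fitting last block is
absorbed or truncated, and all remaining indices are smaller than its top index. The induction is
therefore on the bound `b`, which is why `IH` is needed for every bound up to `N`. -/
theorem ForkRel.hasNormal_mul_down_q {N : ℕ} (hN : N < n - 1)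
    (IH : ∀ b ≤ N, ∀ v ∈ lowerSubmonoid p q b, HasNormal p q n b v) {j : ℕ} (hj : j ≤ N)
    {b : ℕ} (hbN : b ≤ N) {v : M} (hv : v ∈ lowerSubmonoid p q b) :
    HasNormal p q n (N + 1) (v * down q j (N + 1)) := by
  induction b using Nat.strong_induction_on generalizing v with
  | _ b ih =>
  obtain ⟨w, hw, hb, rfl⟩ := IH b hbN v hv
  let c : Block n := ⟨.q, ⟨N, hN⟩, ⟨j, by omega⟩, hj⟩
  have hc : c.elt p q = down q j (N + 1) := rfl
  rcases List.eq_nil_or_concat' w with rfl | ⟨w, e, rfl⟩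
  · exact hc ▸ hasNormal_concat (c := c) (w := []) (by simp)
  by_cases h : e.Before c
  · exact hc ▸ hasNormal_concat (c := c) (isChain_concat.mpr ⟨hw, by simpa using h⟩)
  have hei : (e.i : ℕ) < b := hb e (by simp)
  have hw' : (w.map (Block.elt p q)).prod ∈ lowerSubmonoid p q e.i :=
    prod_mem_lowerSubmonoid (i_lt_of_isChain_concat hw)
  obtain ⟨kind, i, k, hki⟩ := e
  simp only at hei hki hw'
  cases kind with
  | p =>
    have hjk : j ≤ i + 1 := by
      simp only [Block.Before, c] at h
      omega
    simp only [List.map_append, List.map_cons, List.map_nil, List.prod_append, List.prod_cons,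
      List.prod_nil, mul_one, Block.elt]
    rcases le_or_gt j (k + 1) with hkj | hkj
    · rw [mul_assoc, R.down_p_mul_down_q_of_le (by omega) hkj (by omega)]
      exact ih _ hei (by omega) hw'
    · rw [mul_assoc, R.down_p_mul_down_q_of_lt (by omega) hkj hjk (by omega), ← mul_assoc]
      exact ih _ hei (by omega) (mul_mem hw' (down_p_mem_lowerSubmonoid (by omega)))
  | q =>
    have hjk : j ≤ k := by
      simp only [Block.Before, c] at h
      omega
    simp only [List.map_append, List.map_cons, List.map_nil, List.prod_append, List.prod_cons,
      List.prod_nil, mul_one, Block.elt]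
    rw [mul_assoc, R.down_q_mul_down_q (by omega) hjk (by omega)]
    exact ih _ hei (by omega) hw'

theorem ForkRel.hasNormal {b : ℕ} (hb : b ≤ n - 1) {v : M} (hv : v ∈ lowerSubmonoid p q b) :
    HasNormal p q n b v := by
  induction b using Nat.strong_induction_on generalizing v with
  | _ b ih =>
  cases b with
  | zero =>
    have : v = 1 := by simpa [lowerSubmonoid] using hv
    exact ⟨[], by simp, by simp, by simpa using this⟩
  | succ N =>
    have IH : ∀ b ≤ N, ∀ v ∈ lowerSubmonoid p q b, HasNormal p q n b v :=
      fun b hb v hv => ih b (by omega) (by omega) hv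
    obtain ⟨u, hu, rfl | ⟨j, hj, rfl | rfl⟩⟩ := R.hasTop_of_mem_lowerSubmonoid (by omega) hv
    · exact (IH N le_rfl _ hu).mono (by omega)
    · exact R.hasNormal_mul_down_p (by omega) (IH N le_rfl) hj hu
    · exact R.hasNormal_mul_down_q (by omega) IH hj le_rfl hu

end normal

/-! ### Uniqueness: recovering a chain of blocks from its function -/

/-- The right-forking function on natural numbers. -/
def pNat (i : ℕ) : Function.End ℕ := fun x => if x = i + 1 then i else x

/-- The left-forking function on natural numbers. -/
def qNat (i : ℕ) : Function.End ℕ := fun x => if x = i then i + 1 else x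

theorem down_pNat {a b : ℕ} (h : a ≤ b) (x : ℕ) :
    down pNat a b x = if a < x ∧ x ≤ b then x - 1 else x := by
  induction b, h using Nat.le_induction generalizing x with
  | base =>
    rw [down_of_le _ le_rfl, if_neg (by omega)]
    rfl
  | succ b h ih =>
    rw [down_succ _ h]
    change pNat b (down pNat a b x) = _
    rw [ih, pNat]
    split_ifs <;> omega

theorem down_qNat {a b : ℕ} (h : a ≤ b) (x : ℕ) :
    down qNat a b x = if a ≤ x ∧ x < b then b else x := by
  induction b, h using Nat.le_induction generalizing x with
  | base =>
    rw [down_of_le _ le_rfl, if_neg (by omega)]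
    rfl
  | succ b h ih =>
    rw [down_succ _ h]
    change qNat b (down qNat a b x) = _
    rw [ih, qNat]
    split_ifs <;> omega

variable {n : ℕ}

/-- The function on natural numbers denoted by a block. -/
def Block.act (c : Block n) (x : ℕ) : ℕ := c.elt pNat qNat x

/-- The function on natural numbers denoted by a list of blocks. -/
def blocksAct (w : List (Block n)) (x : ℕ) : ℕ := (w.map (Block.elt pNat qNat)).prod x

theorem Block.act_p {i j : Fin (n - 1)} (h : (j : ℕ) ≤ i) (x : ℕ) :
    Block.act ⟨.p, i, j, h⟩ x = if (j : ℕ) < x ∧ x ≤ i + 1 then x - 1 else x :=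
  down_pNat (by simp only; omega) x

theorem Block.act_q {i j : Fin (n - 1)} (h : (j : ℕ) ≤ i) (x : ℕ) :
    Block.act ⟨.q, i, j, h⟩ x = if (j : ℕ) ≤ x ∧ x < i + 1 then (i + 1 : ℕ) else x :=
  down_qNat (by simp only; omega) x

theorem blocksAct_nil (x : ℕ) : blocksAct ([] : List (Block n)) x = x := rfl

theorem blocksAct_concat (w : List (Block n)) (c : Block n) (x : ℕ) :
    blocksAct (w ++ [c]) x = blocksAct w (c.act x) := by
  simp only [blocksAct, List.map_append, List.map_cons, List.map_nil, List.prod_append,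
    List.prod_cons, List.prod_nil, mul_one]
  rfl

theorem Block.act_of_lt (c : Block n) {x : ℕ} (h : (c.i : ℕ) + 1 < x) : c.act x = x := by
  obtain ⟨_ | _, i, j, hij⟩ := c
  · rw [Block.act_p, if_neg (by simp only at h; omega)]
  · rw [Block.act_q, if_neg (by simp only at h; omega)]

theorem Block.act_le (c : Block n) {b x : ℕ} (h : (c.i : ℕ) < b) (hx : x ≤ b) : c.act x ≤ b := by
  obtain ⟨_ | _, i, j, hij⟩ := c
  · rw [Block.act_p]
    split_ifs <;> omega
  · rw [Block.act_q]
    simp only at h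
    split_ifs <;> omega

theorem blocksAct_of_lt {w : List (Block n)} {b x : ℕ} (h : ∀ c ∈ w, (c.i : ℕ) < b)
    (hx : b < x) : blocksAct w x = x := by
  induction w using List.reverseRecOn with
  | nil => rfl
  | append_singleton w c ih =>
    rw [blocksAct_concat, c.act_of_lt (by have := h c (by simp); omega),
      ih fun d hd => h d (by simp [hd])]

theorem blocksAct_le {w : List (Block n)} {b x : ℕ} (h : ∀ c ∈ w, (c.i : ℕ) < b)
    (hx : x ≤ b) : blocksAct w x ≤ b := by
  induction w using List.reverseRecOn generalizing x with
  | nil => exact hx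
  | append_singleton w c ih =>
    rw [blocksAct_concat]
    exact ih (fun d hd => h d (by simp [hd])) (c.act_le (h c (by simp)) hx)

/-- The greatest point that a chain ending in the given block does not fix. -/
def Block.top (c : Block n) : ℕ :=
  match c.kind with
  | .p => c.i + 1
  | .q => c.i

theorem blocksAct_concat_of_top_lt {w : List (Block n)} {c : Block n}
    (h : (w ++ [c]).IsChain Block.Before) {x : ℕ} (hx : c.top < x) :
    blocksAct (w ++ [c]) x = x := by
  have hw := i_lt_of_isChain_concat h
  have hi : (c.i : ℕ) < x := by
    rw [Block.top] at hx
    split at hx <;> omega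
  have hc : c.act x = x := by
    obtain ⟨_ | _, i, j, hij⟩ := c
    · exact Block.act_of_lt _ hx
    · rw [Block.act_q, if_neg (by simp only at hi; omega)]
  rw [blocksAct_concat, hc, blocksAct_of_lt hw hi]

/-- A preceding `p`-block identifies only its lower index `l` with `l + 1`, and `l < j`; a preceding
`q`-block ends below `j`, so the prefix fixes every point from `j` on. Consequently the final
`p`-block alone is responsible for its own collapse. -/
theorem strictMonoOn_blocksAct {w : List (Block n)} {i j : Fin (n - 1)} {hij : (j : ℕ) ≤ i}
    (h : (w ++ [(⟨.p, i, j, hij⟩ : Block n)]).IsChain Block.Before) :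
    StrictMonoOn (blocksAct w) (Set.Ici j) := by
  induction w using List.reverseRecOn generalizing i j hij with
  | nil => exact fun x _ y _ hxy => hxy
  | append_singleton w c ih =>
    obtain ⟨h1, h2⟩ := isChain_concat.mp h
    replace h2 := h2 c (by simp)
    obtain ⟨_ | _, k, l, hkl⟩ := c
    · simp only [Block.Before] at h2
      intro x hx y hy hxy
      rw [Set.mem_Ici] at hx hy
      rw [blocksAct_concat, blocksAct_concat]
      refine ih h1 ?_ ?_ ?_
      all_goals
        simp only [Block.act_p, Set.mem_Ici]
        split_ifs <;> omega
    · simp only [Block.Before] at h2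
      intro x hx y hy hxy
      rw [Set.mem_Ici] at hx hy
      rwa [blocksAct_concat_of_top_lt h1 (by simp only [Block.top]; omega),
        blocksAct_concat_of_top_lt h1 (by simp only [Block.top]; omega)]

/-- The final `q`-block omits `[j, i]` from its image, so the values of the prefix there must be
inferred from `j - 1`. After a `p`-block the prefix fixes `x` and does not push `j - 1` above
itself; after a `q`-block with top `k` it is `max · (k + 1)` from a point below `j` on. -/
theorem blocksAct_eq_max {w : List (Block n)} {i j : Fin (n - 1)} {hij : (j : ℕ) ≤ i}
    (h : (w ++ [(⟨.q, i, j, hij⟩ : Block n)]).IsChain Block.Before) {x : ℕ} (hx : j ≤ x) :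
    blocksAct w x = max x (blocksAct w (j - 1)) := by
  rcases List.eq_nil_or_concat' w with rfl | ⟨w, c, rfl⟩
  · simp only [blocksAct_nil]; omega
  obtain ⟨h1, h2⟩ := isChain_concat.mp h
  replace h2 := h2 c (by simp)
  have hw := i_lt_of_isChain_concat h1
  obtain ⟨_ | _, k, l, hkl⟩ := c
  · simp only [Block.Before] at h2
    simp only at hw
    have e1 : blocksAct (w ++ [⟨.p, k, l, hkl⟩]) x = x := by
      rw [blocksAct_concat, Block.act_of_lt _ (by simp only; omega),
        blocksAct_of_lt hw (by omega)]
    have e2 : blocksAct (w ++ [⟨.p, k, l, hkl⟩]) (j - 1) ≤ j - 1 := by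
      refine blocksAct_le (fun d hd => ?_) le_rfl
      rcases List.mem_append.mp hd with hd | hd
      · have := hw d hd; omega
      · rw [List.mem_singleton.mp hd]; simp only; omega
    rw [e1]; omega
  · simp only [Block.Before] at h2
    simp only at hw
    have e : ∀ y, (l : ℕ) ≤ y → blocksAct (w ++ [⟨.q, k, l, hkl⟩]) y = max y (k + 1) := by
      intro y hy
      rw [blocksAct_concat, blocksAct_of_lt hw, Block.act_q]
      · split_ifs <;> omega
      · rw [Block.act_q]; split_ifs <;> omega
    rw [e x (by omega), e (j - 1) (by omega)]
    omega

theorem blocksAct_concat_p_lt {w : List (Block n)} {i j : Fin (n - 1)} {hij : (j : ℕ) ≤ i}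
    (h : (w ++ [(⟨.p, i, j, hij⟩ : Block n)]).IsChain Block.Before) :
    blocksAct (w ++ [⟨.p, i, j, hij⟩]) (i + 1) < i + 1 := by
  rw [blocksAct_concat, Block.act_p, if_pos (by omega)]
  exact Nat.lt_succ_of_le (blocksAct_le (i_lt_of_isChain_concat h) le_rfl)

theorem blocksAct_concat_q {w : List (Block n)} {i j : Fin (n - 1)} {hij : (j : ℕ) ≤ i}
    (h : (w ++ [(⟨.q, i, j, hij⟩ : Block n)]).IsChain Block.Before) {x : ℕ} (hx : x ≤ i) :
    blocksAct (w ++ [⟨.q, i, j, hij⟩]) x = i + 1 ↔ j ≤ x := by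
  have hw := i_lt_of_isChain_concat h
  rw [blocksAct_concat, Block.act_q]
  split_ifs with hj
  · rw [blocksAct_of_lt hw (by simp only; omega)]
    simp [hj.1]
  · have := blocksAct_le hw hx
    simp only at this
    omega

/-- Everything above the top is fixed, whereas the top itself moves, down for `p` and up for `q`.
Applied both ways, this yields equality of the tops. -/
theorem Block.top_eq_of_blocksAct_eq {w w' : List (Block n)} {c c' : Block n}
    (h : (w ++ [c]).IsChain Block.Before) (h' : (w' ++ [c']).IsChain Block.Before)
    (e : blocksAct (w ++ [c]) = blocksAct (w' ++ [c'])) : c.top ≤ c'.top := by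
  by_contra! hlt
  have e1 := blocksAct_concat_of_top_lt h' hlt
  rw [← e] at e1
  obtain ⟨_ | _, i, j, hij⟩ := c
  · have := blocksAct_concat_p_lt h
    simp only [Block.top] at e1
    omega
  · have := (blocksAct_concat_q h le_rfl).mpr hij
    simp only [Block.top] at e1
    omega

theorem blocksAct_concat_p {w : List (Block n)} {i j : Fin (n - 1)} {hij : (j : ℕ) ≤ i}
    (x : ℕ) : blocksAct (w ++ [⟨.p, i, j, hij⟩]) x =
      blocksAct w (if (j : ℕ) < x ∧ x ≤ i + 1 then x - 1 else x) := by
  rw [blocksAct_concat, Block.act_p]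

theorem p_index_le_of_blocksAct_eq {w w' : List (Block n)} {i j j' : Fin (n - 1)}
    {hij : (j : ℕ) ≤ i} {hij' : (j' : ℕ) ≤ i}
    (h : (w ++ [(⟨.p, i, j, hij⟩ : Block n)]).IsChain Block.Before)
    (e : blocksAct (w ++ [⟨.p, i, j, hij⟩]) = blocksAct (w' ++ [⟨.p, i, j', hij'⟩])) :
    j' ≤ j := by
  by_contra! hlt
  rw [Fin.lt_def] at hlt
  have e1 := congrFun e j'
  have e2 := congrFun e (j' + 1)
  rw [blocksAct_concat_p, blocksAct_concat_p] at e1 e2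
  rw [if_pos (by omega), if_neg (by omega)] at e1
  rw [if_pos (by omega), if_pos (by omega), Nat.add_sub_cancel] at e2
  -- The second chain identifies `j'` and `j' + 1`, which forces `w` to agree at `j' - 1` and `j'`,
  -- both at least `j`.
  have := strictMonoOn_blocksAct h (a := j' - 1) (b := j') (by rw [Set.mem_Ici]; omega)
    (by rw [Set.mem_Ici]; omega) (by omega)
  omega

theorem eq_nil_of_isChain_concat_q {w : List (Block n)} {i j : Fin (n - 1)} {hij : (j : ℕ) ≤ i}
    (h : (w ++ [(⟨.q, i, j, hij⟩ : Block n)]).IsChain Block.Before) (h0 : (j : ℕ) = 0) :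
    w = [] := by
  rcases List.eq_nil_or_concat' w with rfl | ⟨w, c, rfl⟩
  · rfl
  have h2 := (isChain_concat.mp h).2 c (by simp)
  obtain ⟨_ | _, k, l, hkl⟩ := c <;> simp only [Block.Before] at h2 <;> omega

theorem eq_and_blocksAct_eq_of_concat {w w' : List (Block n)} {c c' : Block n}
    (h : (w ++ [c]).IsChain Block.Before) (h' : (w' ++ [c']).IsChain Block.Before)
    (e : blocksAct (w ++ [c]) = blocksAct (w' ++ [c'])) :
    c = c' ∧ blocksAct w = blocksAct w' := by
  have ht := le_antisymm (Block.top_eq_of_blocksAct_eq h h' e)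
    (Block.top_eq_of_blocksAct_eq h' h e.symm)
  obtain ⟨_ | _, i, j, hij⟩ := c <;> obtain ⟨_ | _, i', j', hij'⟩ := c' <;>
    simp only [Block.top] at ht
  · obtain rfl : i = i' := Fin.ext (by omega)
    obtain rfl : j = j' := le_antisymm (p_index_le_of_blocksAct_eq h' e.symm)
      (p_index_le_of_blocksAct_eq h e)
    refine ⟨rfl, funext fun x => ?_⟩
    rcases le_or_gt x j with hx | hx
    · have e1 := congrFun e x
      rwa [blocksAct_concat_p, blocksAct_concat_p, if_neg (by omega)] at e1
    -- Points of `(j, i]` are hit by the `p`-block from `x + 1`; the only point it misses is `i +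
    -- 1`, and both prefixes fix everything above `i`.
    · rcases le_or_gt x i with hx' | hx'
      · have e1 := congrFun e (x + 1)
        rwa [blocksAct_concat_p, blocksAct_concat_p, if_pos (by omega), Nat.add_sub_cancel] at e1
      · rw [blocksAct_of_lt (i_lt_of_isChain_concat h) hx',
          blocksAct_of_lt (i_lt_of_isChain_concat h') hx']
  · have e1 := blocksAct_concat_p_lt h
    have e2 := (blocksAct_concat_q h' le_rfl).mpr hij'
    rw [e, ht] at e1
    omega
  · have e1 := blocksAct_concat_p_lt h'
    have e2 := (blocksAct_concat_q h le_rfl).mpr hij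
    rw [← e, ← ht] at e1
    omega
  · obtain rfl : i = i' := Fin.ext (by omega)
    obtain rfl : j = j' := by
      refine le_antisymm ?_ ?_
      · exact (blocksAct_concat_q h hij').mp (e ▸ (blocksAct_concat_q h' hij').mpr le_rfl)
      · exact (blocksAct_concat_q h' hij).mp (e ▸ (blocksAct_concat_q h hij).mpr le_rfl)
    have e1 : ∀ x < (j : ℕ), blocksAct w x = blocksAct w' x := by
      intro x hx
      have e1 := congrFun e x
      rwa [blocksAct_concat, blocksAct_concat, Block.act_q, if_neg (by omega)] at e1
    refine ⟨rfl, funext fun x => ?_⟩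
    rcases lt_or_ge x j with hx | hx
    · exact e1 x hx
    · rw [blocksAct_eq_max h hx, blocksAct_eq_max h' hx]
      -- For `j = 0` the truncated `j - 1` is not below `j`, so `e1` says nothing about it; but then
      -- no block can precede, and both prefixes are empty.
      rcases Nat.eq_zero_or_pos (j : ℕ) with h0 | h0
      · rw [eq_nil_of_isChain_concat_q h h0, eq_nil_of_isChain_concat_q h' h0]
      · rw [e1 _ (by omega)]

theorem eq_nil_of_blocksAct_eq {w : List (Block n)} (h : w.IsChain Block.Before)
    (e : ∀ x, blocksAct w x = x) : w = [] := by
  rcases List.eq_nil_or_concat' w with rfl | ⟨w, c, rfl⟩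
  · rfl
  obtain ⟨_ | _, i, j, hij⟩ := c
  · have := blocksAct_concat_p_lt h
    rw [e] at this
    omega
  · have := (blocksAct_concat_q h le_rfl).mpr hij
    rw [e] at this
    omega

/-- A chain of blocks is determined by the function it denotes. -/
theorem eq_of_blocksAct_eq {w w' : List (Block n)} (h : w.IsChain Block.Before)
    (h' : w'.IsChain Block.Before) (e : blocksAct w = blocksAct w') : w = w' := by
  induction w using List.reverseRecOn generalizing w' with
  | nil => exact (eq_nil_of_blocksAct_eq h' fun x => by rw [← e, blocksAct_nil]).symm
  | append_singleton w c ih =>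
    rcases List.eq_nil_or_concat' w' with rfl | ⟨w', c', rfl⟩
    · exact eq_nil_of_blocksAct_eq h fun x => by rw [e, blocksAct_nil]
    · obtain ⟨rfl, e'⟩ := eq_and_blocksAct_eq_of_concat h h' e
      rw [ih (isChain_concat.mp h).1 (isChain_concat.mp h').1 e']

/-! ### Generation of monotone functions by forks -/

theorem exists_eq_succ_of_le {f : ℕ → ℕ} (hf : Monotone f) {N : ℕ} (h : f (N + 1) ≤ N) :
    ∃ j ≤ N, f j = f (j + 1) := by
  by_contra! hne
  -- Without a repeated value `f` would be strictly increasing on `{0, …, N + 1}`, hence nowhere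
  -- below the identity.
  have : ∀ x ≤ N + 1, x ≤ f x := by
    intro x hx
    induction x with
    | zero => omega
    | succ x ih =>
      have h1 := ih (by omega)
      have h2 := hne x (by omega)
      have h3 := hf (Nat.le_succ x)
      rw [Nat.succ_eq_add_one] at h3
      omega
  have := this (N + 1) le_rfl
  omega

/-- A function on natural numbers as an element of the monoid of such functions. -/
def natEnd (f : ℕ → ℕ) : Function.End ℕ := f

theorem natEnd_mem_of_eq_comp {S : Submonoid (Function.End ℕ)} {f v : ℕ → ℕ}
    {d : Function.End ℕ} (hv : natEnd v ∈ S) (hd : d ∈ S) (h : ∀ x, f x = v (d x)) :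
    natEnd f ∈ S := by
  have : natEnd f = natEnd v * d := funext h
  rw [this]
  exact mul_mem hv hd

/-- Every monotone function that maps `{0, …, b}` to itself and fixes all greater points is
generated by forks with indices `< b`. -/
theorem mem_lowerSubmonoid_of_monotone {b : ℕ} {f : ℕ → ℕ} (hf : Monotone f)
    (hle : ∀ x ≤ b, f x ≤ b) (hfix : ∀ x, b < x → f x = x) :
    natEnd f ∈ lowerSubmonoid pNat qNat b := by
  induction b generalizing f with
  | zero =>
    have : natEnd f = 1 := by
      funext x
      rcases Nat.eq_zero_or_pos x with rfl | hx
      · change f 0 = 0; exact Nat.le_zero.mp (hle 0 le_rfl)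
      · exact hfix x hx
    rw [this]
    exact one_mem _
  | succ N ih =>
    rcases (hle (N + 1) le_rfl).lt_or_eq with h | h
    · obtain ⟨j, hj, e⟩ := exists_eq_succ_of_le hf (Nat.lt_succ_iff.mp h)
      -- Since `f` identifies `j` and `j + 1`, it factors through the `p`-block that does so; `v`
      -- lists the values of `f` with the repeated one omitted.
      let v : ℕ → ℕ := fun x => if x ≤ j then f x else if x ≤ N then f (x + 1) else x
      have hv : ∀ x, f x = v (down pNat j (N + 1) x) := by
        intro x
        rw [down_pNat (by omega)]
        simp only [v]
        rcases le_or_gt x j with h1 | h1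
        · rw [if_neg (show ¬(j < x ∧ x ≤ N + 1) by omega), if_pos h1]
        rcases le_or_gt x (N + 1) with h2 | h2
        · rw [if_pos (show (j < x ∧ x ≤ N + 1) by omega)]
          rcases eq_or_lt_of_le (Nat.succ_le_of_lt h1) with rfl | h3
          · rw [if_pos (by omega)]
            exact e.symm
          · rw [if_neg (by omega), if_pos (by omega), show x - 1 + 1 = x by omega]
        · rw [if_neg (show ¬(j < x ∧ x ≤ N + 1) by omega), if_neg (by omega), if_neg (by omega), hfix x h2]
      have hb : ∀ x ≤ N + 1, f x ≤ N := fun x hx => (hf hx).trans (by omega)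
      refine natEnd_mem_of_eq_comp (lowerSubmonoid_mono (Nat.le_succ N) (ih (f := v) ?_ ?_ ?_))
        (down_p_mem_lowerSubmonoid le_rfl) hv
      · intro x y hxy
        simp only [v]
        have h1 := hf hxy
        have h2 := hf (show x + 1 ≤ y + 1 by omega)
        have h3 := hf (Nat.le_succ y)
        have h4 := hb x
        have h5 := hb (x + 1)
        simp only [Nat.succ_eq_add_one] at h3
        split_ifs <;> omega
      · intro x hx
        have h4 := hb x
        have h5 := hb (x + 1)
        simp only [v]
        split_ifs <;> omega
      · intro x hx
        simp only [v]
        rw [if_neg (by omega), if_neg (by omega)]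
    · by_cases hN : f N ≤ N
      · refine lowerSubmonoid_mono (Nat.le_succ N)
          (ih (f := f) hf (fun x hx => (hf hx).trans hN) fun x hx => ?_)
        rcases eq_or_lt_of_le (Nat.succ_le_of_lt hx) with rfl | h1
        · exact h
        · exact hfix x h1
      -- Now `f` sends `N` to `N + 1`. With `j` the first point sent there, the `q`-block pushes
      -- `[j, N]` up to the fixed point `N + 1`, so on `[j, N]` the values of `v` are free; capping
      -- `f` at `N` keeps `v` monotone.
      have hex : ∃ j, N < f j := ⟨N, by omega⟩
      have hjN : Nat.find hex ≤ N := Nat.find_min' hex (by omega)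
      have hj := Nat.find_spec hex
      have hmin : ∀ x, x < Nat.find hex → f x ≤ N := fun x hx =>
        not_lt.mp (Nat.find_min hex hx)
      generalize Nat.find hex = j at hjN hj hmin
      let v : ℕ → ℕ := fun x => if x ≤ N then min (f x) N else x
      have hv : ∀ x, f x = v (down qNat j (N + 1) x) := by
        intro x
        rw [down_qNat (by omega)]
        simp only [v]
        rcases lt_or_ge x j with h1 | h1
        · have := hmin x h1
          rw [if_neg (show ¬(j ≤ x ∧ x < N + 1) by omega), if_pos (by omega)]
          omega
        rcases le_or_gt x N with h2 | h2
        · have h3 := hf h1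
          have h4 := hle x (by omega)
          rw [if_pos (show (j ≤ x ∧ x < N + 1) by omega), if_neg (by omega)]
          omega
        · rw [if_neg (show ¬(j ≤ x ∧ x < N + 1) by omega), if_neg (by omega)]
          rcases eq_or_lt_of_le (Nat.succ_le_of_lt h2) with rfl | h3
          · exact h
          · exact hfix x h3
      refine natEnd_mem_of_eq_comp (lowerSubmonoid_mono (Nat.le_succ N) (ih (f := v) ?_ ?_ ?_))
        (down_q_mem_lowerSubmonoid le_rfl) hv
      · intro x y hxy
        have h1 := hf hxy
        simp only [v]
        split_ifs <;> omega
      · intro x hx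
        simp only [v]
        split_ifs; omega
      · intro x hx
        simp only [v]
        rw [if_neg (by omega)]

/-! ### Terms, `O n`, and the isomorphism -/

/-- The generators occurring in a term, from left to right. -/
def Term.letters : Term n → List (Gen n)
  | .one => []
  | .gen g => [g]
  | .comp x y => x.letters ++ y.letters

theorem letters_leftComp (l : List (Gen n)) : (leftComp l).letters = l := by
  cases l with
  | nil => rfl
  | cons g l =>
    have : ∀ (l : List (Gen n)) (t : Term n),
        (l.foldl (fun t h => Term.comp t (.gen h)) t).letters = t.letters ++ l := by
      intro l
      induction l with
      | nil => simp
      | cons h l ih => intro t; simp [ih, Term.letters]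
    exact this l (.gen g)

theorem Term.val_eq_prod (t : Term n) :
    t.val = (t.letters.map (PresentedMonoid.of (Rel n))).prod := by
  induction t with
  | one => rfl
  | gen g => simp [Term.val, Term.letters]
  | comp x y hx hy => simp [Term.val, Term.letters, hx, hy]

/-- The function on natural numbers denoted by a generator. -/
def Gen.act : Gen n → Function.End ℕ
  | .p i => pNat i
  | .q i => qNat i

theorem rightFork_apply (i : Fin (n - 1)) (k : Fin n) :
    (rightFork i k : ℕ) = pNat i k :=
  apply_ite Fin.val _ _ _

theorem leftFork_apply (i : Fin (n - 1)) (k : Fin n) :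
    (leftFork i k : ℕ) = qNat i k :=
  apply_ite Fin.val _ _ _

theorem sigma_apply (t : Term n) (k : Fin n) :
    (sigma t k : ℕ) = (t.letters.map Gen.act).prod k := by
  induction t generalizing k with
  | one => rfl
  | gen g =>
    cases g with
    | p i => simpa [Term.letters, Gen.act, sigma] using rightFork_apply i k
    | q i => simpa [Term.letters, Gen.act, sigma] using leftFork_apply i k
  | comp x y hx hy =>
    simp only [Term.letters, List.map_append, List.prod_append]
    change (sigma x (sigma y k) : ℕ) = (x.letters.map Gen.act).prod ((y.letters.map Gen.act).prod k)
    rw [hx, hy]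

theorem prod_ofFn_eq_down {M : Type*} [Monoid M] (r : ℕ → M) (j l : ℕ) :
    (List.ofFn fun k : Fin (l + 1) => r (j + l - k)).prod = down r j (j + l + 1) := by
  induction l with
  | zero => simp [down_single]
  | succ l ih =>
    rw [List.ofFn_succ, List.prod_cons, down_succ r (by omega), ← Nat.add_assoc j l 1, ← ih]
    congr 4
    funext k
    congr 1
    simp only [Fin.val_succ]
    omega

theorem Block.prod_letters {M : Type*} [Monoid M] {f : Gen n → M} {p q : ℕ → M}
    (hp : ∀ i, f (.p i) = p i) (hq : ∀ i, f (.q i) = q i) (b : Block n) :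
    (b.letters.map f).prod = b.elt p q := by
  obtain ⟨_ | _, i, j, hij⟩ := b
  · have := prod_ofFn_eq_down p j (i - j)
    rw [show (j + (i - j) + 1 : ℕ) = i + 1 by omega] at this
    simp only [Block.letters, Block.elt, List.map_ofFn, Function.comp_def, Kind.gen, hp, ← this]
    congr 4
    funext k
    rw [show (j + (i - j) - k : ℕ) = i - k by omega]
  · have := prod_ofFn_eq_down q j (i - j)
    rw [show (j + (i - j) + 1 : ℕ) = i + 1 by omega] at this
    simp only [Block.letters, Block.elt, List.map_ofFn, Function.comp_def, Kind.gen, hq, ← this]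
    congr 4
    funext k
    rw [show (j + (i - j) - k : ℕ) = i - k by omega]

theorem prod_flatMap_letters {M : Type*} [Monoid M] {f : Gen n → M} {p q : ℕ → M}
    (hp : ∀ i, f (.p i) = p i) (hq : ∀ i, f (.q i) = q i) (w : List (Block n)) :
    ((w.flatMap Block.letters).map f).prod = (w.map (Block.elt p q)).prod := by
  induction w with
  | nil => rfl
  | cons b w ih => simp [List.flatMap_cons, ih, Block.prod_letters hp hq b]

/-- The element of `O n` denoted by `p i`, and `1` when that generator does not exist. -/
def pO (n i : ℕ) : O n := if h : i < n - 1 then PresentedMonoid.of (Rel n) (.p ⟨i, h⟩) else 1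

/-- The element of `O n` denoted by `q i`, and `1` when that generator does not exist. -/
def qO (n i : ℕ) : O n := if h : i < n - 1 then PresentedMonoid.of (Rel n) (.q ⟨i, h⟩) else 1

theorem pO_of_lt {i : ℕ} (h : i < n - 1) : pO n i = PresentedMonoid.mk (Rel n) (P ⟨i, h⟩) :=
  dif_pos h

theorem qO_of_lt {i : ℕ} (h : i < n - 1) : qO n i = PresentedMonoid.mk (Rel n) (Q ⟨i, h⟩) :=
  dif_pos h

theorem forkRel_O (n : ℕ) : ForkRel (n - 1) (pO n) (qO n) where
  p_comm i j hi h := by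
    have := PresentedMonoid.mk_eq_mk_of_rel (Rel.p1 ⟨i, hi⟩ ⟨j, by omega⟩ h)
    rwa [map_mul, map_mul, ← pO_of_lt, ← pO_of_lt] at this
  p_idem i hi := by
    have := PresentedMonoid.mk_eq_mk_of_rel (Rel.p2 ⟨i, hi⟩)
    rwa [map_mul, ← pO_of_lt] at this
  p_left i hi := by
    have h1 := PresentedMonoid.mk_eq_mk_of_rel (Rel.p3_left ⟨i, by omega⟩ ⟨i + 1, hi⟩ rfl)
    have h2 := PresentedMonoid.mk_eq_mk_of_rel (Rel.p3_right ⟨i, by omega⟩ ⟨i + 1, hi⟩ rfl)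
    have := h1.trans h2
    simp only [map_mul, ← pO_of_lt, mul_assoc] at this
    exact this
  p_right i hi := by
    have := PresentedMonoid.mk_eq_mk_of_rel (Rel.p3_right ⟨i, by omega⟩ ⟨i + 1, hi⟩ rfl)
    simp only [map_mul, ← pO_of_lt, mul_assoc] at this
    exact this
  q_comm i j hi h := by
    have := PresentedMonoid.mk_eq_mk_of_rel (Rel.q1 ⟨i, hi⟩ ⟨j, by omega⟩ h)
    rwa [map_mul, map_mul, ← qO_of_lt, ← qO_of_lt] at this
  q_idem i hi := by
    have := PresentedMonoid.mk_eq_mk_of_rel (Rel.q2 ⟨i, hi⟩)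
    rwa [map_mul, ← qO_of_lt] at this
  q_left i hi := by
    have h1 := PresentedMonoid.mk_eq_mk_of_rel (Rel.q3_left ⟨i, by omega⟩ ⟨i + 1, hi⟩ rfl)
    have h2 := PresentedMonoid.mk_eq_mk_of_rel (Rel.q3_right ⟨i, by omega⟩ ⟨i + 1, hi⟩ rfl)
    have := h1.trans h2
    simp only [map_mul, ← qO_of_lt, mul_assoc] at this
    exact this
  q_right i hi := by
    have := PresentedMonoid.mk_eq_mk_of_rel (Rel.q3_right ⟨i, by omega⟩ ⟨i + 1, hi⟩ rfl)
    simp only [map_mul, ← qO_of_lt, mul_assoc] at this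
    exact this
  pq_comm i j hi hj h := by
    have := PresentedMonoid.mk_eq_mk_of_rel (Rel.pq ⟨i, hi⟩ ⟨j, hj⟩ h)
    rwa [map_mul, map_mul, ← pO_of_lt, ← qO_of_lt] at this
  pq_same i hi := by
    have := PresentedMonoid.mk_eq_mk_of_rel (Rel.pq1 ⟨i, hi⟩)
    rwa [map_mul, ← pO_of_lt, ← qO_of_lt] at this
  pq_succ i hi := by
    have := PresentedMonoid.mk_eq_mk_of_rel (Rel.pq2 ⟨i, by omega⟩ ⟨i + 1, hi⟩ rfl)
    rwa [map_mul, ← pO_of_lt, ← qO_of_lt] at this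
  qp_same i hi := by
    have := PresentedMonoid.mk_eq_mk_of_rel (Rel.qp1 ⟨i, hi⟩)
    rwa [map_mul, ← pO_of_lt, ← qO_of_lt] at this
  qp_succ i hi := by
    have := PresentedMonoid.mk_eq_mk_of_rel (Rel.qp2 ⟨i, by omega⟩ ⟨i + 1, hi⟩ rfl)
    rwa [map_mul, ← pO_of_lt, ← qO_of_lt] at this

theorem of_p_eq (i : Fin (n - 1)) : PresentedMonoid.of (Rel n) (.p i) = pO n i :=
  (pO_of_lt i.2).symm

theorem of_q_eq (i : Fin (n - 1)) : PresentedMonoid.of (Rel n) (.q i) = qO n i :=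
  (qO_of_lt i.2).symm

theorem val_leftComp_blocks (w : List (Block n)) :
    (leftComp (w.flatMap Block.letters)).val = (w.map (Block.elt (pO n) (qO n))).prod := by
  rw [Term.val_eq_prod, letters_leftComp, prod_flatMap_letters of_p_eq of_q_eq]

theorem Term.val_mem_lowerSubmonoid (t : Term n) :
    t.val ∈ lowerSubmonoid (pO n) (qO n) (n - 1) := by
  induction t with
  | one => exact one_mem _
  | gen g =>
    cases g with
    | p i => rw [Term.val, of_p_eq]; exact p_mem_lowerSubmonoid i.2
    | q i => rw [Term.val, of_q_eq]; exact q_mem_lowerSubmonoid i.2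
  | comp x y hx hy => exact mul_mem hx hy

theorem Term.exists_isChain (t : Term n) : ∃ w : List (Block n),
    w.IsChain Block.Before ∧ t.val = (leftComp (w.flatMap Block.letters)).val := by
  obtain ⟨w, hw, -, h⟩ := (forkRel_O n).hasNormal le_rfl t.val_mem_lowerSubmonoid
  exact ⟨w, hw, by rw [h, val_leftComp_blocks]⟩

theorem sigma_leftComp_blocks (w : List (Block n)) (k : Fin n) :
    (sigma (leftComp (w.flatMap Block.letters)) k : ℕ) = blocksAct w k := by
  rw [sigma_apply, letters_leftComp,
    prod_flatMap_letters (p := pNat) (q := qNat) (fun _ => rfl) (fun _ => rfl), blocksAct]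

/-- Normal forms with the same interpretation are equal. -/
theorem Term.IsNormal.eq_of_sigma_eq {x y : Term n} (hx : x.IsNormal) (hy : y.IsNormal)
    (h : sigma x = sigma y) : x = y := by
  obtain ⟨w, hw, rfl⟩ := hx
  obtain ⟨w', hw', rfl⟩ := hy
  rw [eq_of_blocksAct_eq hw hw' (funext fun k => ?_)]
  rcases lt_or_ge (n - 1) k with hk | hk
  · rw [blocksAct_of_lt (fun c _ => c.i.2) hk, blocksAct_of_lt (fun c _ => c.i.2) hk]
  -- For `n = 0` the truncated `n - 1` is `0`, a point that the empty ordinal does not contain;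
  -- `blocksAct_le` settles it instead of $\sigma$.
  · rcases Nat.eq_zero_or_pos n with h0 | h0
    · have h1 := blocksAct_le (w := w) (fun c _ => c.i.2) hk
      have h2 := blocksAct_le (w := w') (fun c _ => c.i.2) hk
      omega
    · have := sigma_leftComp_blocks w ⟨k, by omega⟩
      rw [h, sigma_leftComp_blocks] at this
      exact this.symm

theorem exists_letters_of_mem_lowerSubmonoid {f : Function.End ℕ}
    (hf : f ∈ lowerSubmonoid pNat qNat (n - 1)) :
    ∃ t : Term n, (t.letters.map Gen.act).prod = f := by
  induction hf using Submonoid.closure_induction with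
  | mem f hf =>
    obtain ⟨i, hi, rfl | rfl⟩ := hf
    · exact ⟨.gen (.p ⟨i, hi⟩), by simp [Term.letters, Gen.act]⟩
    · exact ⟨.gen (.q ⟨i, hi⟩), by simp [Term.letters, Gen.act]⟩
  | one => exact ⟨.one, rfl⟩
  | mul f g _ _ hf hg =>
    obtain ⟨x, rfl⟩ := hf
    obtain ⟨y, rfl⟩ := hg
    exact ⟨.comp x y, by simp [Term.letters]⟩

theorem sigma_surjective : Function.Surjective (sigma (n := n)) := by
  intro f
  -- To use the generation result on natural numbers, `f` is extended by the identity beyond `n`.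
  have hval : ∀ x (hx : x < n), (if h : x < n then (f ⟨x, h⟩ : ℕ) else x) = f ⟨x, hx⟩ :=
    fun x hx => dif_pos hx
  have hlt : ∀ x, x < n → (if h : x < n then (f ⟨x, h⟩ : ℕ) else x) < n := fun x hx => by
    rw [hval x hx]; exact (f _).2
  have hge : ∀ x, n ≤ x → (if h : x < n then (f ⟨x, h⟩ : ℕ) else x) = x :=
    fun x hx => dif_neg (by omega)
  have hmem : natEnd (fun x => if h : x < n then (f ⟨x, h⟩ : ℕ) else x) ∈
      lowerSubmonoid pNat qNat (n - 1) := by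
    refine mem_lowerSubmonoid_of_monotone ?_ ?_ ?_
    · intro x y hxy
      rcases lt_or_ge y n with hy | hy
      · simp only [hval x (hxy.trans_lt hy), hval y hy]
        exact f.monotone hxy
      · simp only [hge y hy]
        rcases lt_or_ge x n with hx | hx
        · have := hlt x hx
          omega
        · rw [hge x hx]; exact hxy
    · intro x hx
      rcases lt_or_ge x n with hx' | hx'
      · have := hlt x hx'
        omega
      · simp only [hge x hx']
        exact hx
    · intro x hx
      exact hge x (by omega)
  obtain ⟨t, ht⟩ := exists_letters_of_mem_lowerSubmonoid hmem
  refine ⟨t, OrderHom.ext _ _ (funext fun k => Fin.ext ?_)⟩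
  rw [sigma_apply, ht]
  exact hval k k.2

/-- The endomorphism denoted by a generator. -/
def Gen.fork (g : Gen n) : Fin n →o Fin n := sigma (.gen g)

theorem lift_fork_eq_of_rel {x y : FreeMonoid (Gen n)} (h : Rel n x y) :
    FreeMonoid.lift Gen.fork x = FreeMonoid.lift Gen.fork y := by
  have hP : ∀ i : Fin (n - 1), FreeMonoid.lift Gen.fork (P i) = rightFork i := fun _ => rfl
  have hQ : ∀ i : Fin (n - 1), FreeMonoid.lift Gen.fork (Q i) = leftFork i := fun _ => rfl
  have hmul : ∀ (f g : Fin n →o Fin n) (k : Fin n), (f * g) k = f (g k) := fun _ _ _ => rfl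
  refine OrderHom.ext _ _ (funext fun k => Fin.ext ?_)
  cases h <;> simp only [map_mul, hP, hQ, hmul, rightFork_apply, leftFork_apply,
    pNat, qNat] <;> split_ifs <;> omega

/-- The homomorphism induced by the interpretation of terms. -/
def sigmaHom (n : ℕ) : O n →* (Fin n →o Fin n) :=
  PresentedMonoid.lift Gen.fork fun _ _ h => lift_fork_eq_of_rel h

theorem sigmaHom_val (t : Term n) : sigmaHom n t.val = sigma t := by
  induction t with
  | one => exact map_one _
  | gen g => rfl
  | comp x y hx hy => rw [Term.val, map_mul, hx, hy]; rfl

theorem val_surjective : Function.Surjective (Term.val (n := n)) := by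
  intro x
  have hx : x ∈ Submonoid.closure (Set.range (PresentedMonoid.of (Rel n))) := by
    rw [PresentedMonoid.closure_range_of]; trivial
  induction hx using Submonoid.closure_induction with
  | mem x hx => obtain ⟨g, rfl⟩ := hx; exact ⟨.gen g, rfl⟩
  | one => exact ⟨.one, rfl⟩
  | mul x y _ _ hx hy =>
    obtain ⟨t, rfl⟩ := hx
    obtain ⟨u, rfl⟩ := hy
    exact ⟨.comp t u, rfl⟩

theorem Term.exists_isNormal (t : Term n) : ∃ t' : Term n, t'.IsNormal ∧ t.val = t'.val := by
  obtain ⟨w, hw, h⟩ := t.exists_isChain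
  exact ⟨_, ⟨w, hw, rfl⟩, h⟩

/-- Faithfulness: both terms are replaced by normal forms, which the relations cannot distinguish
from the originals and which $\sigma$ separates. -/
theorem val_eq_iff_sigma_eq {x y : Term n} : x.val = y.val ↔ sigma x = sigma y := by
  refine ⟨fun h => by rw [← sigmaHom_val, h, sigmaHom_val], fun h => ?_⟩
  obtain ⟨x', hx', ex⟩ := x.exists_isNormal
  obtain ⟨y', hy', ey⟩ := y.exists_isNormal
  rw [ex, ey, hx'.eq_of_sigma_eq hy' ?_]
  rw [← sigmaHom_val, ← sigmaHom_val, ← ex, ← ey, sigmaHom_val, sigmaHom_val, h]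

theorem sigmaHom_bijective : Function.Bijective (sigmaHom n) := by
  constructor
  · intro x y h
    obtain ⟨t, rfl⟩ := val_surjective x
    obtain ⟨u, rfl⟩ := val_surjective y
    rw [sigmaHom_val, sigmaHom_val] at h
    exact val_eq_iff_sigma_eq.mpr h
  · intro f
    obtain ⟨t, rfl⟩ := sigma_surjective f
    exact ⟨t.val, sigmaHom_val t⟩

theorem Term.existsUnique_isNormal (t : Term n) :
    ∃! t' : Term n, t'.IsNormal ∧ t.val = t'.val := by
  obtain ⟨t', ht', e⟩ := t.exists_isNormal
  refine ⟨t', ⟨ht', e⟩, fun u ⟨hu, eu⟩ => hu.eq_of_sigma_eq ht' ?_⟩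
  exact val_eq_iff_sigma_eq.mp (eu.symm.trans e)

/-! ### Computability -/

/-- A search for a solution of a primitive recursive condition is computable when there always is
a solution. -/
theorem exists_computable_of_forall_exists {α β : Type*} [Primcodable α] [Denumerable β]
    {R : α → β → Prop} (hR : PrimrecRel R) (h : ∀ a, ∃ b, R a b) :
    ∃ f : α → β, Computable f ∧ ∀ a, R a (f a) := by
  classical
  have h' : ∀ a, ∃ m : ℕ, R a (Denumerable.ofNat β m) := fun a =>
    (h a).imp' Encodable.encode fun b hb => by rwa [Denumerable.ofNat_encode]
  have hp : Primrec₂ fun (a : α) (m : ℕ) => decide (R a (Denumerable.ofNat β m)) :=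
    PrimrecRel.decide (hR.comp₂ Primrec₂.left ((Primrec.ofNat β).comp₂ Primrec₂.right))
  have hfind : Computable fun a => Nat.find (h' a) := by
    refine (Partrec.rfind hp.to_comp.partrec₂).of_eq fun a => ?_
    refine Part.eq_some_iff.mpr (Nat.mem_rfind.mpr ⟨?_, fun hm => ?_⟩)
    · exact Part.mem_some_iff.mpr (decide_eq_true (Nat.find_spec (h' a))).symm
    · exact Part.mem_some_iff.mpr (decide_eq_false (Nat.find_min (h' a) hm)).symm
  exact ⟨fun a => Denumerable.ofNat β (Nat.find (h' a)), (Primrec.ofNat β).to_comp.comp hfind,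
    fun a => Nat.find_spec (h' a)⟩

/-! ### Deciding equality on codes -/

/-- The codes of the generators occurring in the term with the given code. -/
def codeLetters (c : ℕ) : List ℕ :=
  if c % 3 = 0 then
    if c = 0 then [] else
      codeLetters (c / 3 - 1).unpair.1 ++ codeLetters (c / 3 - 1).unpair.2
  else [c]
termination_by c
decreasing_by
  · have := Nat.unpair_left_le (c / 3 - 1)
    omega
  · have := Nat.unpair_right_le (c / 3 - 1)
    omega

theorem primrec_codeLetters : Primrec codeLetters := by
  -- Course-of-values recursion: `l` holds all earlier values, so `l.length` is the current
  -- argument. Both components of the unpairing are smaller than it, so the default of `getI` is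
  -- never read.
  let g : Unit → List (List ℕ) → Option (List ℕ) := fun _ l =>
    some (if l.length % 3 = 0 then
      if l.length = 0 then [] else
        l.getI (l.length / 3 - 1).unpair.1 ++ l.getI (l.length / 3 - 1).unpair.2
      else [l.length])
  have hlen : Primrec fun p : Unit × List (List ℕ) => p.2.length :=
    Primrec.list_length.comp Primrec.snd
  have hsub : Primrec fun p : Unit × List (List ℕ) => (p.2.length / 3 - 1).unpair :=
    Primrec.unpair.comp (Primrec.nat_sub.comp (Primrec.nat_div.comp hlen (Primrec.const 3))
      (Primrec.const 1))
  have hg : Primrec₂ g := by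
    refine Primrec.option_some.comp (Primrec.ite
      (Primrec.eq.comp (Primrec.nat_mod.comp hlen (Primrec.const 3)) (Primrec.const 0))
      (Primrec.ite (Primrec.eq.comp hlen (Primrec.const 0)) (Primrec.const [])
        (Primrec.list_append.comp
          (Primrec.list_getI.comp Primrec.snd (Primrec.fst.comp hsub))
          (Primrec.list_getI.comp Primrec.snd (Primrec.snd.comp hsub))))
      (Primrec.list_cons.comp hlen (Primrec.const [])))
  have : Primrec₂ fun (_ : Unit) c => codeLetters c := by
    refine Primrec.nat_strong_rec _ hg fun _ c => ?_
    have hget : ∀ i < c, ((List.range c).map codeLetters).getI i = codeLetters i := by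
      intro i hi
      rw [List.getI_eq_getElem _ (by simpa using hi)]
      simp
    simp only [g, List.length_map, List.length_range, Option.some.injEq]
    rw [codeLetters]
    split_ifs with h1 h2
    · rfl
    · have := Nat.unpair_left_le (c / 3 - 1)
      have := Nat.unpair_right_le (c / 3 - 1)
      rw [hget _ (by omega), hget _ (by omega)]
    · rfl
  exact this.comp (Primrec.const ()) Primrec.id

/-- The code of a generator. -/
def Gen.code {n : ℕ} (g : Gen n) : ℕ := (Term.gen g).code

theorem codeLetters_code {n : ℕ} (t : Term n) : codeLetters t.code = t.letters.map Gen.code := by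
  induction t with
  | one => rw [codeLetters]; rfl
  | gen g =>
    have : (Term.gen g).code % 3 ≠ 0 := by
      cases g <;> simp only [Term.code] <;> omega
    rw [codeLetters, if_neg this]
    rfl
  | comp x y hx hy =>
    rw [codeLetters, Term.code, if_pos (by omega), if_neg (by omega),
      show (3 * Nat.pair x.code y.code + 3) / 3 - 1 = Nat.pair x.code y.code by omega,
      Nat.unpair_pair, hx, hy, Term.letters, List.map_append]

/-- The function denoted by the generator with the given code. -/
def codeAct (l x : ℕ) : ℕ :=
  if l % 3 = 1 then (if x = l / 3 + 1 then l / 3 else x)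
  else (if x = l / 3 then l / 3 + 1 else x)

theorem primrec_codeAct : Primrec₂ codeAct := by
  have h3 : Primrec fun p : ℕ × ℕ => p.1 / 3 := Primrec.nat_div.comp Primrec.fst (Primrec.const 3)
  have h3' : Primrec fun p : ℕ × ℕ => p.1 / 3 + 1 := Primrec.succ.comp h3
  exact Primrec.ite
    (Primrec.eq.comp (Primrec.nat_mod.comp Primrec.fst (Primrec.const 3)) (Primrec.const 1))
    (Primrec.ite (Primrec.eq.comp Primrec.snd h3') h3 Primrec.snd)
    (Primrec.ite (Primrec.eq.comp Primrec.snd h3) h3' Primrec.snd)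

/-- The function denoted by a list of codes of generators. -/
def codesAct (l : List ℕ) (x : ℕ) : ℕ := l.foldr codeAct x

theorem primrec_codesAct : Primrec₂ codesAct :=
  Primrec.list_foldr Primrec.fst Primrec.snd (primrec_codeAct.comp₂
    (Primrec.fst.comp₂ Primrec₂.right) (Primrec.snd.comp₂ Primrec₂.right))

theorem codeAct_code {n : ℕ} (g : Gen n) (x : ℕ) : codeAct g.code x = g.act x := by
  cases g with
  | p i =>
    rw [codeAct, Gen.code, Term.code, if_pos (by omega), show (3 * (i : ℕ) + 1) / 3 = i by omega]
    rfl
  | q i =>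
    rw [codeAct, Gen.code, Term.code, if_neg (by omega), show (3 * (i : ℕ) + 2) / 3 = i by omega]
    rfl

theorem codesAct_map_code {n : ℕ} (l : List (Gen n)) (x : ℕ) :
    codesAct (l.map Gen.code) x = (l.map Gen.act).prod x := by
  induction l with
  | nil => rfl
  | cons g l ih =>
    rw [List.map_cons, List.map_cons, List.prod_cons]
    change codeAct g.code (codesAct (l.map Gen.code) x) = g.act ((l.map Gen.act).prod x)
    rw [codeAct_code, ih]

/-- Denoting the same function on `{0, …, n - 1}`. -/
def CodesAgree (n : ℕ) (l : List ℕ × List ℕ) : Prop :=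
  ∀ k < n, codesAct l.1 k = codesAct l.2 k

theorem primrecRel_codesAgree : PrimrecRel CodesAgree := by
  have h : PrimrecRel fun (k : ℕ) (l : List ℕ × List ℕ) => codesAct l.1 k = codesAct l.2 k :=
    Primrec.eq.comp
      (primrec_codesAct.comp (Primrec.fst.comp Primrec.snd) Primrec.fst)
      (primrec_codesAct.comp (Primrec.snd.comp Primrec.snd) Primrec.fst)
  refine (h.forall_mem_list.comp (Primrec.list_range.comp Primrec.fst) Primrec.snd).of_eq
    fun a => ?_
  simp only [List.mem_range, CodesAgree]

/-- Through faithfulness of $\sigma$, equality in `O n` becomes a comparison at finitely many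
points, which is primitive recursive. -/
theorem codesAgree_iff {n : ℕ} (x y : Term n) :
    CodesAgree n (codeLetters x.code, codeLetters y.code) ↔ x.val = y.val := by
  rw [val_eq_iff_sigma_eq, codeLetters_code, codeLetters_code]
  simp only [CodesAgree, codesAct_map_code]
  constructor
  · intro h
    refine OrderHom.ext _ _ (funext fun k => Fin.ext ?_)
    rw [sigma_apply, sigma_apply, h k k.2]
  · intro h k hk
    rw [← sigma_apply x ⟨k, hk⟩, h, sigma_apply]

/-- The word problem is decidable, uniformly in `n`. -/
theorem exists_computable_decision : ∃ D : ℕ × ℕ × ℕ → Bool, Computable D ∧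
    ∀ (n : ℕ) (x y : Term n), D (n, x.code, y.code) = true ↔ x.val = y.val := by
  classical
  refine ⟨fun a => decide (CodesAgree a.1 (codeLetters a.2.1, codeLetters a.2.2)),
    (PrimrecPred.decide (primrecRel_codesAgree.comp Primrec.fst (Primrec.pair
      (primrec_codeLetters.comp (Primrec.fst.comp Primrec.snd))
      (primrec_codeLetters.comp (Primrec.snd.comp Primrec.snd))))).to_comp, fun n x y => ?_⟩
  rw [decide_eq_true_iff, codesAgree_iff]

/-- The code of the composition of the generators with the given codes. -/
def leftCompCode (l : List ℕ) : ℕ :=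
  -- For the empty list `headI` is `0`, which is exactly the code of the term `1`.
  l.tail.foldl (fun t h => 3 * Nat.pair t h + 3) l.headI

theorem primrec_leftCompCode : Primrec leftCompCode :=
  Primrec.list_foldl Primrec.list_tail Primrec.list_headI
    (Primrec.nat_add.comp (Primrec.nat_mul.comp (Primrec.const 3)
      (Primrec₂.natPair.comp (Primrec.fst.comp Primrec.snd) (Primrec.snd.comp Primrec.snd)))
      (Primrec.const 3)).to₂

theorem leftCompCode_map_code {n : ℕ} (l : List (Gen n)) :
    leftCompCode (l.map Gen.code) = (leftComp l).code := by
  cases l with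
  | nil => rfl
  | cons g l =>
    have : ∀ (l : List (Gen n)) (t : Term n),
        (l.map Gen.code).foldl (fun t h => 3 * Nat.pair t h + 3) t.code =
          (l.foldl (fun t h => Term.comp t (.gen h)) t).code := by
      intro l
      induction l with
      | nil => intro t; rfl
      | cons h l ih => intro t; exact ih (.comp t (.gen h))
    exact this l (.gen g)

/-! ### Computing normal forms on codes -/

/-- A block as a triple of numbers: `1` or `2` for its kind, and its two indices. -/
def Block.triple {n : ℕ} (b : Block n) : ℕ × ℕ × ℕ :=
  (match b.kind with
    | .p => 1
    | .q => 2, b.i, b.j)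

/-- Being the triple of a block. -/
def IsTriple (t : ℕ × ℕ × ℕ) (n : ℕ) : Prop :=
  ((t.1 = 1 ∨ t.1 = 2) ∧ t.2.1 + 1 < n) ∧ t.2.2 ≤ t.2.1

theorem isTriple_iff {t : ℕ × ℕ × ℕ} {n : ℕ} :
    IsTriple t n ↔ t ∈ Set.range (Block.triple (n := n)) := by
  constructor
  · obtain ⟨k, i, j⟩ := t
    rintro ⟨⟨h1, h2⟩, h3⟩
    simp only at h1 h2 h3
    rcases h1 with rfl | rfl
    · exact ⟨⟨.p, ⟨i, by omega⟩, ⟨j, by omega⟩, h3⟩, rfl⟩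
    · exact ⟨⟨.q, ⟨i, by omega⟩, ⟨j, by omega⟩, h3⟩, rfl⟩
  · rintro ⟨⟨_ | _, i, j, h⟩, rfl⟩
    · exact ⟨⟨.inl rfl, by simp only [Block.triple]; omega⟩, h⟩
    · exact ⟨⟨.inr rfl, by simp only [Block.triple]; omega⟩, h⟩

theorem primrecRel_isTriple : PrimrecRel IsTriple := by
  have h1 : Primrec fun p : (ℕ × ℕ × ℕ) × ℕ => p.1.1 := Primrec.fst.comp Primrec.fst
  have h2 : Primrec fun p : (ℕ × ℕ × ℕ) × ℕ => p.1.2.1 :=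
    Primrec.fst.comp (Primrec.snd.comp Primrec.fst)
  have h3 : Primrec fun p : (ℕ × ℕ × ℕ) × ℕ => p.1.2.2 :=
    Primrec.snd.comp (Primrec.snd.comp Primrec.fst)
  exact (((Primrec.eq.comp h1 (Primrec.const 1)).or (Primrec.eq.comp h1 (Primrec.const 2))).and
    (Primrec.nat_lt.comp (Primrec.succ.comp h2) Primrec.snd)).and (Primrec.nat_le.comp h3 h2)

/-- The relation `Block.Before` for triples. -/
def TripleBefore (s t : ℕ × ℕ × ℕ) : Prop :=
  ((s.1 = t.1 ∧ s.2.1 < t.2.1 ∧ s.2.2 < t.2.2) ∨ ((s.1 = 1 ∧ t.1 = 2) ∧ s.2.1 + 1 < t.2.2)) ∨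
    ((s.1 = 2 ∧ t.1 = 1) ∧ s.2.1 < t.2.2)

theorem tripleBefore_triple {n : ℕ} (b c : Block n) :
    TripleBefore b.triple c.triple ↔ b.Before c := by
  obtain ⟨_ | _, i, j, h⟩ := b <;> obtain ⟨_ | _, i', j', h'⟩ := c <;>
    simp [TripleBefore, Block.triple, Block.Before]

theorem primrecRel_tripleBefore : PrimrecRel TripleBefore := by
  have s1 : Primrec fun p : (ℕ × ℕ × ℕ) × (ℕ × ℕ × ℕ) => p.1.1 := Primrec.fst.comp Primrec.fst
  have s2 : Primrec fun p : (ℕ × ℕ × ℕ) × (ℕ × ℕ × ℕ) => p.1.2.1 :=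
    Primrec.fst.comp (Primrec.snd.comp Primrec.fst)
  have s3 : Primrec fun p : (ℕ × ℕ × ℕ) × (ℕ × ℕ × ℕ) => p.1.2.2 :=
    Primrec.snd.comp (Primrec.snd.comp Primrec.fst)
  have t1 : Primrec fun p : (ℕ × ℕ × ℕ) × (ℕ × ℕ × ℕ) => p.2.1 := Primrec.fst.comp Primrec.snd
  have t2 : Primrec fun p : (ℕ × ℕ × ℕ) × (ℕ × ℕ × ℕ) => p.2.2.1 :=
    Primrec.fst.comp (Primrec.snd.comp Primrec.snd)
  have t3 : Primrec fun p : (ℕ × ℕ × ℕ) × (ℕ × ℕ × ℕ) => p.2.2.2 :=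
    Primrec.snd.comp (Primrec.snd.comp Primrec.snd)
  have hc : ∀ k : ℕ, Primrec fun _ : (ℕ × ℕ × ℕ) × (ℕ × ℕ × ℕ) => k := Primrec.const
  exact (((Primrec.eq.comp s1 t1).and ((Primrec.nat_lt.comp s2 t2).and
      (Primrec.nat_lt.comp s3 t3))).or
    (((Primrec.eq.comp s1 (hc 1)).and (Primrec.eq.comp t1 (hc 2))).and
      (Primrec.nat_lt.comp (Primrec.succ.comp s2) t3))).or
    (((Primrec.eq.comp s1 (hc 2)).and (Primrec.eq.comp t1 (hc 1))).and (Primrec.nat_lt.comp s2 t3))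

theorem primrecPred_isChain {α : Type*} [Primcodable α] [Inhabited α] {R : α → α → Prop}
    (hR : PrimrecRel R) : PrimrecPred fun l : List α => l.IsChain R := by
  have h : PrimrecRel fun (k : ℕ) (l : List α) => R (l.getI k) (l.getI (k + 1)) :=
    hR.comp (Primrec.list_getI.comp Primrec.snd Primrec.fst)
      (Primrec.list_getI.comp Primrec.snd (Primrec.succ.comp Primrec.fst))
  refine (h.forall_mem_list.comp (Primrec.list_range.comp (Primrec.pred.comp Primrec.list_length))
    Primrec.id).of_eq fun l => ?_
  rw [List.isChain_iff_getElem]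
  refine forall_congr' fun k => ?_
  constructor
  · intro h hk
    have := h (List.mem_range.mpr (by simp only [Nat.pred_eq_sub_one]; omega))
    rwa [id, List.getI_eq_getElem _ (by omega), List.getI_eq_getElem _ hk] at this
  · intro h hk
    simp only [List.mem_range, Nat.pred_eq_sub_one] at hk
    rw [id, List.getI_eq_getElem _ (by omega), List.getI_eq_getElem _ (by omega)]
    exact h (by omega)

/-- The codes of the generators of the block given by a triple. -/
def tripleCodes (t : ℕ × ℕ × ℕ) : List ℕ :=
  (List.range (t.2.1 - t.2.2 + 1)).map fun k => 3 * (t.2.1 - k) + t.1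

theorem primrec_tripleCodes : Primrec tripleCodes := by
  have h2 : Primrec fun t : ℕ × ℕ × ℕ => t.2.1 := Primrec.fst.comp Primrec.snd
  exact Primrec.list_map
    (Primrec.list_range.comp (Primrec.succ.comp
      (Primrec.nat_sub.comp h2 (Primrec.snd.comp Primrec.snd))))
    (Primrec.nat_add.comp (Primrec.nat_mul.comp (Primrec.const 3)
      (Primrec.nat_sub.comp (h2.comp Primrec.fst) Primrec.snd)) (Primrec.fst.comp Primrec.fst))

theorem tripleCodes_triple {n : ℕ} (b : Block n) :
    tripleCodes b.triple = b.letters.map Gen.code := by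
  obtain ⟨_ | _, i, j, h⟩ := b
  all_goals
    refine List.ext_getElem (by simp [tripleCodes, Block.triple, Block.letters]) fun k h1 h2 => ?_
    simp only [tripleCodes, Block.triple, Block.letters, Kind.gen, Gen.code, Term.code,
      List.getElem_map, List.getElem_range, List.getElem_ofFn]

theorem flatMap_tripleCodes {n : ℕ} (w : List (Block n)) :
    (w.map Block.triple).flatMap tripleCodes = (w.flatMap Block.letters).map Gen.code := by
  rw [List.flatMap_map, List.map_flatMap]
  simp only [tripleCodes_triple]

/-- Not being the code of a generator. -/
def IsBadCode (l n : ℕ) : Prop := l % 3 = 0 ∨ n ≤ l / 3 + 1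

theorem primrecRel_isBadCode : PrimrecRel IsBadCode :=
  (Primrec.eq.comp (Primrec.nat_mod.comp Primrec.fst (Primrec.const 3)) (Primrec.const 0)).or
    (Primrec.nat_le.comp Primrec.snd
      (Primrec.succ.comp (Primrec.nat_div.comp Primrec.fst (Primrec.const 3))))

theorem not_isBadCode_iff {l n : ℕ} :
    ¬IsBadCode l n ↔ l ∈ Set.range (Gen.code (n := n)) := by
  rw [IsBadCode, not_or, not_le]
  constructor
  · rintro ⟨h1, h2⟩
    rcases (show l % 3 = 1 ∨ l % 3 = 2 by omega) with h | h
    · exact ⟨.p ⟨l / 3, by omega⟩, by simp only [Gen.code, Term.code]; omega⟩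
    · exact ⟨.q ⟨l / 3, by omega⟩, by simp only [Gen.code, Term.code]; omega⟩
  · rintro ⟨i | i, rfl⟩ <;> simp only [Gen.code, Term.code] <;> omega

/-- The list `w` of triples is a normal form for the term of `O a.1` with code `a.2`, if there is
such a term. -/
def IsNormalWord (a : ℕ × ℕ) (w : List (ℕ × ℕ × ℕ)) : Prop :=
  -- Any list is accepted for an input that codes no term of `O a.1`; this makes the relation total,
  -- so that the search always halts.
  (∃ l ∈ codeLetters a.2, IsBadCode l a.1) ∨
    ((∀ t ∈ w, IsTriple t a.1) ∧ w.IsChain TripleBefore) ∧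
      CodesAgree a.1 (codeLetters a.2, w.flatMap tripleCodes)

theorem primrecRel_isNormalWord : PrimrecRel IsNormalWord := by
  have hn : Primrec fun p : (ℕ × ℕ) × List (ℕ × ℕ × ℕ) => p.1.1 := Primrec.fst.comp Primrec.fst
  have hc : Primrec fun p : (ℕ × ℕ) × List (ℕ × ℕ × ℕ) => codeLetters p.1.2 :=
    primrec_codeLetters.comp (Primrec.snd.comp Primrec.fst)
  exact (primrecRel_isBadCode.exists_mem_list.comp hc hn).or
    (((primrecRel_isTriple.forall_mem_list.comp Primrec.snd hn).and
      ((primrecPred_isChain primrecRel_tripleBefore).comp Primrec.snd)).and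
      (primrecRel_codesAgree.comp hn (Primrec.pair hc
        (Primrec.list_flatMap Primrec.snd (primrec_tripleCodes.comp₂ Primrec₂.right)))))

theorem codeLetters_code_leftComp {n : ℕ} (w : List (Block n)) :
    codeLetters (leftComp (w.flatMap Block.letters)).code =
      (w.map Block.triple).flatMap tripleCodes := by
  rw [codeLetters_code, letters_leftComp, flatMap_tripleCodes]

theorem isChain_map_triple {n : ℕ} (w : List (Block n)) :
    (w.map Block.triple).IsChain TripleBefore ↔ w.IsChain Block.Before := by
  simp only [List.isChain_map, tripleBefore_triple]

/-- Only the letters of the input matter, so a number whose letters are all valid can be treated as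
the left-associated composition of those letters. -/
theorem exists_isNormalWord (a : ℕ × ℕ) : ∃ w, IsNormalWord a w := by
  obtain ⟨n, c⟩ := a
  by_cases hbad : ∃ l ∈ codeLetters c, IsBadCode l n
  · exact ⟨[], .inl hbad⟩
  push Not at hbad
  obtain ⟨l, hl⟩ : codeLetters c ∈ Set.range (List.map (Gen.code (n := n))) := by
    rw [Set.range_list_map]
    exact fun l hl => not_isBadCode_iff.mp (hbad l hl)
  obtain ⟨w, hw, e⟩ := (leftComp l).exists_isChain
  refine ⟨w.map Block.triple, .inr ⟨⟨?_, (isChain_map_triple w).mpr hw⟩, ?_⟩⟩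
  · intro t ht
    obtain ⟨b, -, rfl⟩ := List.mem_map.mp ht
    exact isTriple_iff.mpr ⟨b, rfl⟩
  · rw [← codesAgree_iff, codeLetters_code_leftComp, codeLetters_code, letters_leftComp, hl] at e
    exact e

/-- The normal form is computable, uniformly in `n`. -/
theorem exists_computable_normalForm : ∃ N : ℕ × ℕ → ℕ, Computable N ∧
    ∀ (n : ℕ) (x : Term n), ∃ x' : Term n, x'.IsNormal ∧ x.val = x'.val ∧
      N (n, x.code) = x'.code := by
  obtain ⟨f, hf, hfw⟩ := exists_computable_of_forall_exists primrecRel_isNormalWord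
    exists_isNormalWord
  refine ⟨fun a => leftCompCode ((f a).flatMap tripleCodes), ?_, fun n x => ?_⟩
  · have : Primrec fun w : List (ℕ × ℕ × ℕ) => leftCompCode (w.flatMap tripleCodes) :=
      primrec_leftCompCode.comp
        (Primrec.list_flatMap Primrec.id (primrec_tripleCodes.comp₂ Primrec₂.right))
    exact this.to_comp.comp hf
  rcases hfw (n, x.code) with ⟨l, hl, hbad⟩ | ⟨⟨htriple, hchain⟩, hagree⟩
  · rw [codeLetters_code] at hl
    obtain ⟨g, -, rfl⟩ := List.mem_map.mp hl
    exact absurd hbad (not_isBadCode_iff.mpr ⟨g, rfl⟩)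
  · obtain ⟨w, hw⟩ : f (n, x.code) ∈ Set.range (List.map (Block.triple (n := n))) := by
      rw [Set.range_list_map]
      exact fun t ht => isTriple_iff.mp (htriple t ht)
    rw [← hw] at hchain hagree
    refine ⟨leftComp (w.flatMap Block.letters), ⟨w, (isChain_map_triple w).mp hchain, rfl⟩, ?_, ?_⟩
    · rw [← codesAgree_iff, codeLetters_code_leftComp]
      exact hagree
    · simp only [← hw]
      rw [flatMap_tripleCodes, leftCompCode_map_code]

end SimplicialEnd

open SimplicialEnd in
theorem mainTheorem1 :
    -- the interpretation of terms is well defined on `O n` and gives an isomorphism of `O n`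
    -- with the monoid of order-preserving endomorphisms of the ordinal `n`
    (∀ n : ℕ, ∃ e : O n ≃* (Fin n →o Fin n), ∀ x : Term n, e x.val = sigma x) ∧
    -- every term is equal in `O n` to exactly one term in normal form
    (∀ (n : ℕ) (x : Term n), ∃! x' : Term n, x'.IsNormal ∧ x.val = x'.val) ∧
    -- the normal form is computable, uniformly in `n`
    (∃ N : ℕ × ℕ → ℕ, Computable N ∧ ∀ (n : ℕ) (x : Term n),
      ∃ x' : Term n, x'.IsNormal ∧ x.val = x'.val ∧ N (n, x.code) = x'.code) ∧
    -- the word problem is decidable, uniformly in `n`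
    (∃ D : ℕ × ℕ × ℕ → Bool, Computable D ∧ ∀ (n : ℕ) (x y : Term n),
      D (n, x.code, y.code) = true ↔ x.val = y.val) := by
  exact ⟨fun n => ⟨MulEquiv.ofBijective (sigmaHom n) sigmaHom_bijective, sigmaHom_val⟩,
    fun _ x => x.existsUnique_isNormal, exists_computable_normalForm, exists_computable_decision⟩
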